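/- Let $Q^1$ be the class of real-valued $q\in L^1(\mathbb R)$ with $q=0$ a.e. outside $[0,1]$ that vanish a.e. neither on any right neighbourhood of $0$ nor on any left neighbourhood of $1$. For $q\in Q^1$ and $k\in\mathbb C$ let $\psi_\pm(x,k)$ be the Jost solutions of $-y''+q(x)y=k^2y$, i.e. the solutions with $\psi_+(x,k)=e^{ikx}$ for $x\ge 1$ and $\psi_-(x,k)=e^{-ikx}$ for $x\le 0$, and let $\omega_q(k)=\psi_-(x,k)\psi_+'(x,k)-\psi_-'(x,k)\psi_+(x,k)$, an entire function of $k$ that does not depend on $x$. Let $\{k_j\}_{j\ge1}$ be its zeros, listed with multiplicity; $k_j^2$ is an eigenvalue of the Schrödinger operator $L(q)=-\frac{d^2}{dx^2}+q$ on $L^2(\mathbb R)$ if $\operatorname{Im}k_j>0$, and a resonance if $\operatorname{Im}k_j\le0$. For a subfamily $\Omega$ of $\{k_j\}$ (a set of zeros, each taken with a multiplicity not exceeding its multiplicity as a zero of $\omega_q$) let $N_\Omega(r)$ be the number of members of $\Omega$, counted with multiplicity, in the disk $|k|\le r$. **Theorem 2.** Let $\frac12<a\le1$ and $\gamma>2(1-a)$,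 let $q\in Q^1$, and let $\Omega$ be a subfamily of the zeros of $\omega_q$ with $$N_\Omega(r)=\frac{2\gamma r}{\pi}\,[1+o(1)],\qquad r\to+\infty .$$ Then $q$ on $[0,a]$ and $\Omega$ together determine $q$ a.e. on $[0,1]$: if $\tilde q\in Q^1$, $\tilde q=q$ a.e. on $[0,a]$, and $\Omega$ is also a subfamily of the zeros of $\omega_{\tilde q}$, then $\tilde q=q$ a.e. on $[0,1]$. In particular, $\Omega$ need not contain all eigenvalues and resonances, and infinitely many of them may be missing: every such $\Omega$ contains a subfamily $\Omega'$ which omits infinitely many distinct members of $\Omega$ altogether, still satisfies $N_{\Omega'}(r)=\frac{2\gamma r}{\pi}[1+o(1)]$, and hence still determines $q$ a.e. on $[0,1]$ together with $q$ on $[0,a]$. -/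

import Mathlib

open MeasureTheory Filter

noncomputable section

namespace InverseResonance

/-- The class `Q¹`: real integrable potentials on the line that vanish a.e. outside `[0, 1]` and
vanish a.e. neither on any right neighbourhood of `0` nor on any left neighbourhood of `1`. -/
structure Q1 (q : ℝ → ℝ) : Prop where
  integrable : Integrable q
  support : ∀ᵐ x, x ∉ Set.Icc (0 : ℝ) 1 → q x = 0
  left_end : ∀ ε > (0 : ℝ), ¬ ∀ᵐ x, x ∈ Set.Ioo (0 : ℝ) ε → q x = 0
  right_end : ∀ ε > (0 : ℝ), ¬ ∀ᵐ x, x ∈ Set.Ioo (1 - ε) (1 : ℝ) → q x = 0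

/-- `y` solves `-y'' + q y = k² y` on the line in the Carathéodory sense: `y` is differentiable and
`y'` is an indefinite integral of `(q - k²) y`. For locally integrable `q` this says that `y'` is
locally absolutely continuous and that the equation holds a.e. -/
structure IsSolution (q : ℝ → ℝ) (k : ℂ) (y : ℝ → ℂ) : Prop where
  differentiable : Differentiable ℝ y
  deriv_sub : ∀ x₁ x₂ : ℝ,
    deriv y x₂ - deriv y x₁ = ∫ t in x₁..x₂, ((q t : ℂ) - k ^ 2) * y t

/-- `y` is the Jost solution `ψ₊(·, k)`: it solves the equation and is `e^{ikx}` for `x ≥ 1`. -/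
def IsJostPlus (q : ℝ → ℝ) (k : ℂ) (y : ℝ → ℂ) : Prop :=
  IsSolution q k y ∧ ∀ x : ℝ, 1 ≤ x → y x = Complex.exp (Complex.I * k * x)

/-- `y` is the Jost solution `ψ₋(·, k)`: it solves the equation and is `e^{-ikx}` for `x ≤ 0`. -/
def IsJostMinus (q : ℝ → ℝ) (k : ℂ) (y : ℝ → ℂ) : Prop :=
  IsSolution q k y ∧ ∀ x : ℝ, x ≤ 0 → y x = Complex.exp (-(Complex.I * k * x))

/-- `ψ₊(·, k)`. For `q ∈ Q¹` exactly one function satisfies `IsJostPlus q k`. -/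
def jostPlus (q : ℝ → ℝ) (k : ℂ) : ℝ → ℂ := Classical.epsilon (IsJostPlus q k)

/-- `ψ₋(·, k)`. For `q ∈ Q¹` exactly one function satisfies `IsJostMinus q k`. -/
def jostMinus (q : ℝ → ℝ) (k : ℂ) : ℝ → ℂ := Classical.epsilon (IsJostMinus q k)

/-- The Wronskian `{f, g} = f g' - f' g` at `x`. -/
def wronskian (f g : ℝ → ℂ) (x : ℝ) : ℂ := f x * deriv g x - deriv f x * g x

/-- `ω(k) = {ψ₋(x, k), ψ₊(x, k)}`; the Wronskian does not depend on `x`, so it is taken at `0`. -/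
def omega (q : ℝ → ℝ) (k : ℂ) : ℂ := wronskian (jostMinus q k) (jostPlus q k) 0

/-- `Ω` is a subfamily of the family of the zeros of `ω`, listed with multiplicity. The number `Ω z`
says how many times `z` occurs in the subfamily. The zeros `k` of `ω` are the numbers for which `k²`
is an eigenvalue (`Im k > 0`) or a resonance (`Im k ≤ 0`). -/
def IsSubfamilyOfZeros (Ω : ℂ → ℕ) (q : ℝ → ℝ) : Prop :=
  ∀ z : ℂ, (Ω z : ℕ∞) ≤ analyticOrderAt (omega q) z

/-- The counting function `N_Ω(r)`: the number of members of `Ω`, with multiplicity, in the closed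
disk `|k| ≤ r`. (For a subfamily of the zeros of `ω` the sum is finite.) -/
def count (Ω : ℂ → ℕ) (r : ℝ) : ℕ := ∑ᶠ z ∈ Metric.closedBall (0 : ℂ) r, Ω z

/-- `N_Ω(r) = (2γr/π) (1 + o(1))` as `r → +∞`. -/
def HasDensity (Ω : ℂ → ℕ) (γ : ℝ) : Prop :=
  Asymptotics.IsEquivalent atTop (fun r : ℝ => (count Ω r : ℝ)) fun r : ℝ => 2 * γ * r / Real.pi

/-- `Ω`, together with the values of `q` a.e. on `[0, a]`, determines `q` a.e. on `[0, 1]`: every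
potential of class `Q¹` that agrees with `q` a.e. on `[0, a]` and has `Ω` among the zeros of its `ω`
agrees with `q` a.e. on `[0, 1]`. -/
def Determines (a : ℝ) (Ω : ℂ → ℕ) (q : ℝ → ℝ) : Prop :=
  ∀ p : ℝ → ℝ, Q1 p → (∀ᵐ x, x ∈ Set.Icc (0 : ℝ) a → p x = q x) → IsSubfamilyOfZeros Ω p →
    ∀ᵐ x, x ∈ Set.Icc (0 : ℝ) 1 → p x = q x

end InverseResonance

end

/-! Let `p` and `q` agree on `[0, a]`, so that their left Jost solutions share the Cauchy data `(u,
u')` at `a`. With `W(k) = {ψ₊(q), ψ₊(p)}(a)` one has `u W = ψ₊(q) ω_p - ψ₊(p) ω_q` at `a`, and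
likewise with `u'` and the derivatives of `ψ₊`. Since `u` and `u'` never vanish together, each
common zero of `ω_q` and `ω_p` is a zero of `W` of at least the common multiplicity
(`le_analyticOrderAt_wronskian_jostPlus`).

The two right Jost solutions coincide at `1`, so `W` is an integral over `[a, 1]` of `(p - q) ψ₊(q)
ψ₊(p)`, up to sign. Hence `e^{-2ik} W(k)` is `O(exp (2(1-a)|Im k|))`. By Jensen's formula a nonzero
entire function with this bound cannot have zeros of density `2γ/π` with `γ > 2(1-a)`
(`eq_zero_of_hasDensity`), so `W = 0`.

It remains to recover the potential on `[a, 1]` from the ratio `ψ₊'/ψ₊` at `a`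
(`ae_eq_of_wronskian_jostPlus_eq_zero`). The cross product of the fundamental systems of `q` and `p`
is entire and even in `k`; proportionality of the Jost solutions makes it `O(1/|k|)` in the upper
half-plane, so Liouville's theorem kills it. The two systems are then proportional, normalization of
the Wronskians makes them equal, and the equation returns the potential.

For the last claim, an infinite set of zeros so sparse that it has density zero is removed
(`HasDensity.exists_thinning`). -/

noncomputable section

namespace InverseResonance

/-! ### Carathéodory solutions and the Wronskian identity -/

section

open Set intervalIntegral Topology

/-- An indefinite integral of a complex integrable function is absolutely continuous. -/
lemma absolutelyContinuousOnInterval_integral {f : ℝ → ℂ} {a b : ℝ}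
    (hf : ∀ c d, IntervalIntegrable f volume c d) :
    AbsolutelyContinuousOnInterval (fun x => ∫ t in a..x, f t) a b := by
  have h := ((hf a b).norm).absolutelyContinuousOnInterval_intervalIntegral (c := a) (by simp)
  refine squeeze_zero (fun E => Finset.sum_nonneg fun i _ => dist_nonneg) (fun E => ?_) h
  refine Finset.sum_le_sum fun i _ => ?_
  rw [dist_comm, dist_eq_norm, dist_comm, dist_eq_norm, integral_interval_sub_left (hf _ _) (hf _ _),
    integral_interval_sub_left (hf _ _).norm (hf _ _).norm, Real.norm_eq_abs]
  exact norm_integral_le_abs_integral_norm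

lemma intervalIntegrable_ofReal {q : ℝ → ℝ} (hq : Integrable q) (a b : ℝ) :
    IntervalIntegrable (fun t => (q t : ℂ)) volume a b :=
  (hq.ofReal (𝕜 := ℂ)).intervalIntegrable

lemma intervalIntegrable_potential_mul {q : ℝ → ℝ} (hq : Integrable q) (k : ℂ) {y : ℝ → ℂ}
    (hy : Continuous y) (a b : ℝ) :
    IntervalIntegrable (fun t => ((q t : ℂ) - k ^ 2) * y t) volume a b :=
  ((intervalIntegrable_ofReal hq a b).sub intervalIntegrable_const).mul_continuousOn
    hy.continuousOn

section

variable {p q : ℝ → ℝ} {k : ℂ} {f g y : ℝ → ℂ}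

lemma IsSolution.continuous (hy : IsSolution q k y) : Continuous y := hy.differentiable.continuous

lemma IsSolution.hasDerivAt (hy : IsSolution q k y) (x : ℝ) : HasDerivAt y (deriv y x) x :=
  (hy.differentiable x).hasDerivAt

lemma IsSolution.deriv_eq (hy : IsSolution q k y) (x₀ : ℝ) :
    deriv y = fun x => deriv y x₀ + ∫ t in x₀..x, ((q t : ℂ) - k ^ 2) * y t := by
  funext x
  rw [← hy.deriv_sub x₀ x]
  ring

lemma IsSolution.continuous_deriv (hq : Integrable q) (hy : IsSolution q k y) :
    Continuous (deriv y) := by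
  rw [hy.deriv_eq 0]
  exact continuous_const.add
    (continuous_primitive (intervalIntegrable_potential_mul hq k hy.continuous) 0)

lemma absolutelyContinuousOnInterval_const (c : ℂ) (a b : ℝ) :
    AbsolutelyContinuousOnInterval (fun _ : ℝ => c) a b :=
  (LipschitzOnWith.of_dist_le_mul (K := 0) (by simp)).absolutelyContinuousOnInterval

lemma IsSolution.ac_deriv (hq : Integrable q) (hy : IsSolution q k y) (a b : ℝ) :
    AbsolutelyContinuousOnInterval (deriv y) a b := by
  rw [hy.deriv_eq a]
  exact (absolutelyContinuousOnInterval_const _ _ _).fun_add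
    (absolutelyContinuousOnInterval_integral
      (intervalIntegrable_potential_mul hq k hy.continuous))

lemma IsSolution.ac (hq : Integrable q) (hy : IsSolution q k y) (a b : ℝ) :
    AbsolutelyContinuousOnInterval y a b :=
  (contDiff_one_iff_deriv.2
    ⟨hy.differentiable, hy.continuous_deriv hq⟩).contDiffOn.absolutelyContinuousOnInterval

lemma IsSolution.ae_hasDerivAt_deriv (hq : Integrable q) (hy : IsSolution q k y) (a b : ℝ) :
    ∀ᵐ x, x ∈ uIcc a b → HasDerivAt (deriv y) (((q x : ℂ) - k ^ 2) * y x) x := by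
  filter_upwards [(intervalIntegrable_potential_mul hq k hy.continuous a b).ae_hasDerivAt_integral]
    with x hx hxab
  rw [hy.deriv_eq a]
  exact (hx hxab a (by simp)).const_add _

/-- The derivative of the Wronskian of solutions for two potentials, in integrated form. -/
lemma wronskian_sub (hq : Integrable q) (hp : Integrable p) (hf : IsSolution q k f)
    (hg : IsSolution p k g) (x₁ x₂ : ℝ) :
    wronskian f g x₂ - wronskian f g x₁ = ∫ t in x₁..x₂, ((p t : ℂ) - q t) * (f t * g t) := by
  have hint : ∀ c d, IntervalIntegrable (fun t => ((p t : ℂ) - q t) * (f t * g t)) volume c d :=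
    fun c d => ((intervalIntegrable_ofReal hp c d).sub
      (intervalIntegrable_ofReal hq c d)).mul_continuousOn
        (hf.continuous.mul hg.continuous).continuousOn
  -- The derivative formula holds only a.e.; absolute continuity is what turns a zero a.e.
  -- derivative into constancy.
  have hac : AbsolutelyContinuousOnInterval
      (fun x => wronskian f g x - ∫ t in x₁..x, ((p t : ℂ) - q t) * (f t * g t)) x₁ x₂ :=
    (((hf.ac hq _ _).fun_smul (hg.ac_deriv hp _ _)).fun_sub
      ((hf.ac_deriv hq _ _).fun_smul (hg.ac hp _ _))).fun_sub
        (absolutelyContinuousOnInterval_integral hint)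
  obtain ⟨C, hC⟩ := hac.const_of_ae_hasDerivAt_zero (by
    filter_upwards [hf.ae_hasDerivAt_deriv hq x₁ x₂, hg.ae_hasDerivAt_deriv hp x₁ x₂,
      (hint x₁ x₂).ae_hasDerivAt_integral] with x h1 h2 h3 hx
    have := (((hf.hasDerivAt x).mul (h2 hx)).sub ((h1 hx).mul (hg.hasDerivAt x))).sub
      (h3 hx x₁ (by simp))
    refine this.congr_deriv ?_
    ring)
  have h1 := hC x₁ (by simp)
  have h2 := hC x₂ (by simp)
  simp only [integral_same, sub_zero] at h1
  rw [h1, ← h2]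
  ring

lemma wronskian_eq (hq : Integrable q) (hf : IsSolution q k f) (hg : IsSolution q k g)
    (x₁ x₂ : ℝ) : wronskian f g x₂ = wronskian f g x₁ := by
  have := wronskian_sub hq hq hf hg x₁ x₂
  simpa [sub_eq_zero] using this

/-- The Wronskian does not change along an interval where the two potentials agree. -/
lemma wronskian_eq_of_ae_eq (hq : Integrable q) (hp : Integrable p) (hf : IsSolution q k f)
    (hg : IsSolution p k g) {x₁ x₂ : ℝ} (h : ∀ᵐ x, x ∈ uIoc x₁ x₂ → p x = q x) :
    wronskian f g x₂ = wronskian f g x₁ := by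
  rw [← sub_eq_zero, wronskian_sub hq hp hf hg x₁ x₂]
  refine integral_zero_ae ?_
  filter_upwards [h] with x hx hxm
  simp [hx hxm]

lemma IsSolution.add (hq : Integrable q) (hf : IsSolution q k f) (hg : IsSolution q k g) :
    IsSolution q k (fun x => f x + g x) := by
  have hd : deriv (fun x => f x + g x) = fun x => deriv f x + deriv g x :=
    funext fun x => ((hf.hasDerivAt x).add (hg.hasDerivAt x)).deriv
  refine ⟨hf.differentiable.add hg.differentiable, fun x₁ x₂ => ?_⟩
  simp only [hd, mul_add]
  rw [integral_add (intervalIntegrable_potential_mul hq k hf.continuous _ _)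
    (intervalIntegrable_potential_mul hq k hg.continuous _ _), ← hf.deriv_sub, ← hg.deriv_sub]
  ring

lemma IsSolution.const_mul (c : ℂ) (hf : IsSolution q k f) :
    IsSolution q k (fun x => c * f x) := by
  have hd : deriv (fun x => c * f x) = fun x => c * deriv f x :=
    funext fun x => ((hf.hasDerivAt x).const_mul c).deriv
  refine ⟨hf.differentiable.const_mul c, fun x₁ x₂ => ?_⟩
  simp only [hd]
  rw [← mul_sub, hf.deriv_sub, ← intervalIntegral.integral_const_mul]
  congr 1
  funext t
  ring

lemma IsSolution.neg_param (hf : IsSolution q k f) : IsSolution q (-k) f :=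
  ⟨hf.differentiable, by simpa using hf.deriv_sub⟩

end

end

/-! ### Existence of solutions and analyticity in the spectral parameter -/

section

open Set intervalIntegral Topology BoundedContinuousFunction

/-- The Volterra operator `f ↦ ∫_{x₀}^x V f`, conjugated by the weight `exp (l |x - x₀|)`. -/
lemma exists_weighted_volterra (x₀ l C : ℝ) (hC : 0 ≤ C) (V : ℝ → ℂ)
    (hV : ∀ a b, IntervalIntegrable V volume a b)
    (hb : ∀ x, |∫ t in x₀..x, ‖V t‖ * Real.exp (l * |t - x₀|)| ≤ C * Real.exp (l * |x - x₀|)) :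
    ∃ T : (ℝ →ᵇ ℂ) →L[ℂ] (ℝ →ᵇ ℂ), ‖T‖ ≤ C ∧ ∀ m x, Real.exp (l * |x - x₀|) * T m x =
      ∫ t in x₀..x, V t * (Real.exp (l * |t - x₀|) * m t) := by
  have hw : Continuous fun t : ℝ => ((Real.exp (l * |t - x₀|) : ℝ) : ℂ) := by fun_prop
  have hint : ∀ (m : ℝ →ᵇ ℂ) a b,
      IntervalIntegrable (fun t => V t * (Real.exp (l * |t - x₀|) * m t)) volume a b :=
    fun m a b => (hV a b).mul_continuousOn (hw.mul m.continuous).continuousOn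
  have hint' : ∀ a b,
      IntervalIntegrable (fun t => ‖V t‖ * Real.exp (l * |t - x₀|)) volume a b :=
    fun a b => (hV a b).norm.mul_continuousOn (by fun_prop)
  have hbound : ∀ (m : ℝ →ᵇ ℂ) x, ‖(Real.exp (-(l * |x - x₀|)) : ℂ) *
      ∫ t in x₀..x, V t * (Real.exp (l * |t - x₀|) * m t)‖ ≤ C * ‖m‖ := by
    intro m x
    have h1 : ‖∫ t in x₀..x, V t * (Real.exp (l * |t - x₀|) * m t)‖
        ≤ |∫ t in x₀..x, (‖V t‖ * Real.exp (l * |t - x₀|)) * ‖m‖| := by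
      refine norm_integral_le_abs_of_norm_le (Eventually.of_forall fun t => ?_)
        ((hint' _ _).mul_const _)
      rw [norm_mul, norm_mul, Complex.norm_real, Real.norm_eq_abs, Real.abs_exp, mul_assoc]
      gcongr
      exact m.norm_coe_le_norm t
    rw [intervalIntegral.integral_mul_const, abs_mul, abs_of_nonneg (norm_nonneg m)] at h1
    rw [norm_mul, Complex.norm_real, Real.norm_eq_abs, Real.abs_exp]
    calc Real.exp (-(l * |x - x₀|)) * ‖∫ t in x₀..x, V t * (Real.exp (l * |t - x₀|) * m t)‖
        ≤ Real.exp (-(l * |x - x₀|)) * (C * Real.exp (l * |x - x₀|) * ‖m‖) := by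
          gcongr
          exact h1.trans (by gcongr; exact hb x)
      _ = C * ‖m‖ * (Real.exp (-(l * |x - x₀|)) * Real.exp (l * |x - x₀|)) := by ring
      _ = C * ‖m‖ := by rw [← Real.exp_add]; simp
  let T₀ : (ℝ →ᵇ ℂ) → (ℝ →ᵇ ℂ) := fun m => BoundedContinuousFunction.ofNormedAddCommGroup
    (fun x => (Real.exp (-(l * |x - x₀|)) : ℂ) *
      ∫ t in x₀..x, V t * (Real.exp (l * |t - x₀|) * m t))
    (Continuous.mul (by fun_prop) (continuous_primitive (hint m) x₀)) (C * ‖m‖) (hbound m)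
  let T₁ : (ℝ →ᵇ ℂ) →ₗ[ℂ] (ℝ →ᵇ ℂ) :=
    { toFun := T₀
      map_add' := fun m n => by
        ext x
        simp only [T₀, coe_ofNormedAddCommGroup, BoundedContinuousFunction.coe_add, Pi.add_apply,
          mul_add]
        rw [integral_add (hint m _ _) (hint n _ _), mul_add]
      map_smul' := fun c m => by
        ext x
        simp only [T₀, coe_ofNormedAddCommGroup, BoundedContinuousFunction.coe_smul, smul_eq_mul,
          RingHom.id_apply]
        rw [mul_left_comm c, ← intervalIntegral.integral_const_mul c]
        congr 2
        funext t
        ring }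
  refine ⟨T₁.mkContinuous C fun m => ?_, LinearMap.mkContinuous_norm_le _ hC _, fun m x => ?_⟩
  · refine (BoundedContinuousFunction.norm_le (by positivity)).2 (hbound m)
  · change (Real.exp (l * |x - x₀|) : ℂ) * ((Real.exp (-(l * |x - x₀|)) : ℂ) * _) = _
    rw [← mul_assoc, ← Complex.ofReal_mul, ← Real.exp_add]
    simp

lemma abs_sub_le_of_mem_uIcc {x₀ x t : ℝ} (ht : t ∈ uIcc x₀ x) : |t - x₀| ≤ |x - x₀| := by
  simpa using abs_sub_left_of_mem_uIcc ht

lemma abs_integral_mul_exp_le {f : ℝ → ℝ} (hf : Integrable f) (hf0 : ∀ t, 0 ≤ f t) {l : ℝ}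
    (hl : 0 ≤ l) (x₀ x : ℝ) :
    |∫ t in x₀..x, f t * Real.exp (l * |t - x₀|)| ≤ (∫ t, f t) * Real.exp (l * |x - x₀|) := by
  have h1 : |∫ t in x₀..x, f t * Real.exp (l * |t - x₀|)| ≤
      |∫ t in x₀..x, f t * Real.exp (l * |x - x₀|)| := by
    rw [← Real.norm_eq_abs]
    refine norm_integral_le_abs_of_norm_le ?_ (hf.intervalIntegrable.mul_const _)
    refine (ae_restrict_iff' measurableSet_uIoc).2 (Eventually.of_forall fun t ht => ?_)
    rw [norm_mul, Real.norm_of_nonneg (hf0 t), Real.norm_eq_abs, Real.abs_exp]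
    have := abs_sub_le_of_mem_uIcc (uIoc_subset_uIcc ht)
    have := hf0 t
    gcongr
  refine h1.trans ?_
  rw [intervalIntegral.integral_mul_const, abs_mul, Real.abs_exp]
  gcongr
  rw [abs_integral_eq_abs_integral_uIoc, abs_of_nonneg (setIntegral_nonneg measurableSet_uIoc
    fun t _ => hf0 t)]
  exact setIntegral_le_integral hf (Eventually.of_forall hf0)

/-- Plain integration gains a factor `l⁻¹` in the weighted norm, whereas integration against a
potential in `L¹` is only bounded by its norm. One gain is enough to make the composition a
contraction. -/
lemma abs_integral_exp_le {l : ℝ} (hl : 0 < l) (x₀ x : ℝ) :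
    |∫ t in x₀..x, ‖(1 : ℂ)‖ * Real.exp (l * |t - x₀|)| ≤ l⁻¹ * Real.exp (l * |x - x₀|) := by
  have key : ∀ s : ℝ, 0 ≤ s → ∫ t in (0 : ℝ)..s, Real.exp (l * t) ≤ l⁻¹ * Real.exp (l * s) := by
    intro s _
    rw [intervalIntegral.integral_comp_mul_left (fun t => Real.exp t) hl.ne', integral_exp,
      smul_eq_mul]
    have := inv_pos.2 hl
    have := Real.exp_pos (l * 0)
    gcongr
    linarith
  simp only [norm_one, one_mul]
  rcases le_total x₀ x with h | h
  · have : ∫ t in x₀..x, Real.exp (l * |t - x₀|) = ∫ t in (0 : ℝ)..(x - x₀), Real.exp (l * t) := by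
      rw [intervalIntegral.integral_comp_sub_right (fun t => Real.exp (l * |t|)) x₀, sub_self]
      refine integral_congr fun t ht => ?_
      rw [uIcc_of_le (by linarith)] at ht
      simp [abs_of_nonneg ht.1]
    rw [this, abs_of_nonneg (intervalIntegral.integral_nonneg (by linarith)
      fun t _ => (Real.exp_pos _).le), abs_of_nonneg (by linarith)]
    exact key _ (by linarith)
  · have : ∫ t in x₀..x, Real.exp (l * |t - x₀|) =
        - ∫ t in (0 : ℝ)..(x₀ - x), Real.exp (l * t) := by
      have h2 := intervalIntegral.integral_comp_sub_left (a := x₀) (b := x)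
        (fun t => Real.exp (l * |t|)) x₀
      simp only [abs_sub_comm x₀, sub_self] at h2
      rw [h2, integral_symm]
      congr 1
      refine integral_congr fun t ht => ?_
      rw [uIcc_of_le (by linarith)] at ht
      simp [abs_of_nonneg ht.1]
    rw [this, abs_neg, abs_of_nonneg (intervalIntegral.integral_nonneg (by linarith)
      fun t _ => (Real.exp_pos _).le), abs_of_nonpos (by linarith), neg_sub]
    exact key _ (by linarith)

/-- A pair of continuous functions satisfying the first-order integral system yields a solution. -/
lemma isSolution_of_integral_system {q : ℝ → ℝ} (hq : Integrable q) {k c d : ℂ} {x₀ : ℝ}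
    {y z : ℝ → ℂ} (hy : Continuous y) (hz : Continuous z)
    (h1 : ∀ x, y x = c + ∫ t in x₀..x, z t)
    (h2 : ∀ x, z x = d + ∫ t in x₀..x, ((q t : ℂ) - k ^ 2) * y t) :
    IsSolution q k y ∧ deriv y = z := by
  have hd : ∀ x, HasDerivAt y (z x) x := fun x => by
    rw [show y = fun x => c + ∫ t in x₀..x, z t from funext h1]
    exact (hz.integral_hasStrictDerivAt x₀ x).hasDerivAt.const_add c
  have hd' : deriv y = z := funext fun x => (hd x).deriv
  refine ⟨⟨fun x => (hd x).differentiableAt, fun x₁ x₂ => ?_⟩, hd'⟩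
  have hi := intervalIntegrable_potential_mul hq k hy
  rw [hd', h2 x₁, h2 x₂, add_sub_add_left_eq_sub, integral_interval_sub_left (hi _ _) (hi _ _)]

lemma differentiable_pencil {E : Type*} [NormedAddCommGroup E] [NormedSpace ℂ E]
    (A B : E →L[ℂ] E) : Differentiable ℂ fun k : ℂ => A - k ^ 2 • B :=
  (differentiable_const A).sub ((differentiable_id.pow 2).smul_const B)

lemma differentiableAt_inverse_one_sub {E : Type*} [NormedAddCommGroup E] [NormedSpace ℂ E]
    [CompleteSpace E] {S : ℂ → E →L[ℂ] E} (hS : Differentiable ℂ S) {k : ℂ}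
    (hu : IsUnit (1 - S k)) : DifferentiableAt ℂ (fun k => Ring.inverse (1 - S k)) k :=
  DifferentiableAt.comp (g := fun T : E →L[ℂ] E => Ring.inverse T) k
    (differentiableAt_inverse (𝕜 := ℂ) (R := E →L[ℂ] E) hu)
    ((differentiableAt_const (1 : E →L[ℂ] E)).fun_sub (hS k))

/-- The equation is the system `y = c + ∫ z`, `z = d + ∫ (q - k²) y`. Eliminating `z` in the
weighted space leaves `(1 - S k) m = const`, with `S` polynomial in `k`; the inverse, hence the
solution, is analytic in `k`. The weight depends on `R`, which is why `k` stays in a ball. -/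
lemma exists_solution_family {q : ℝ → ℝ} (hq : Integrable q) (x₀ : ℝ) (c d : ℂ) {R : ℝ}
    (hR : 0 < R) :
    ∃ Y : ℂ → ℝ → ℂ, ∀ k ∈ Metric.ball (0 : ℂ) R,
      IsSolution q k (Y k) ∧ Y k x₀ = c ∧ deriv (Y k) x₀ = d ∧
      ∀ x, DifferentiableAt ℂ (fun k => Y k x) k ∧
        DifferentiableAt ℂ (fun k => deriv (Y k) x) k := by
  set Q : ℝ := ∫ t, ‖(q t : ℂ)‖ with hQ
  have hQ0 : 0 ≤ Q := integral_nonneg fun t => norm_nonneg _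
  -- Chosen so that `‖S k‖ ≤ l⁻¹ (Q + R²) < 1` on the ball.
  set l : ℝ := Q + R ^ 2 + 1 with hl
  have hl1 : 1 ≤ l := by nlinarith [sq_nonneg R]
  have hl0 : 0 < l := by linarith
  obtain ⟨A, hA, hA'⟩ := exists_weighted_volterra x₀ l Q hQ0 (fun t => (q t : ℂ))
    (intervalIntegrable_ofReal hq)
    (abs_integral_mul_exp_le (hq.ofReal (𝕜 := ℂ)).norm (fun t => norm_nonneg _) hl0.le x₀)
  obtain ⟨B, hB, hB'⟩ := exists_weighted_volterra x₀ l l⁻¹ (by positivity) (fun _ => (1 : ℂ))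
    (fun a b => intervalIntegrable_const) (abs_integral_exp_le hl0 x₀)
  simp only [one_mul] at hB'
  -- This represents the constant function `1` after division by the weight.
  let n₀ : ℝ →ᵇ ℂ := BoundedContinuousFunction.ofNormedAddCommGroup
    (fun x => (Real.exp (-(l * |x - x₀|)) : ℂ)) (by fun_prop) 1 (fun x => by
      rw [Complex.norm_real, Real.norm_eq_abs, Real.abs_exp, Real.exp_le_one_iff]
      have := abs_nonneg (x - x₀)
      nlinarith)
  have hn₀ : ∀ x, (Real.exp (l * |x - x₀|) : ℂ) * n₀ x = 1 := fun x => by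
    change (Real.exp (l * |x - x₀|) : ℂ) * (Real.exp (-(l * |x - x₀|)) : ℂ) = 1
    rw [← Complex.ofReal_mul, ← Real.exp_add]
    simp
  let D : ℂ → (ℝ →ᵇ ℂ) →L[ℂ] (ℝ →ᵇ ℂ) := fun k => A - k ^ 2 • B
  let S : ℂ → (ℝ →ᵇ ℂ) →L[ℂ] (ℝ →ᵇ ℂ) := fun k => B * D k
  let m : ℂ → (ℝ →ᵇ ℂ) := fun k => Ring.inverse (1 - S k) (c • n₀ + d • B n₀)
  let z : ℂ → (ℝ →ᵇ ℂ) := fun k => d • n₀ + D k (m k)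
  have hD : Differentiable ℂ D := differentiable_pencil A B
  have hS : Differentiable ℂ S := (differentiable_const B).clm_comp hD
  have hunit : ∀ k ∈ Metric.ball (0 : ℂ) R, IsUnit (1 - S k) := by
    intro k hk
    rw [mem_ball_zero_iff] at hk
    refine isUnit_one_sub_of_norm_lt_one (R := (ℝ →ᵇ ℂ) →L[ℂ] (ℝ →ᵇ ℂ)) ?_
    have h1 : ‖D k‖ ≤ Q + R ^ 2 * l⁻¹ := by
      refine (norm_sub_le _ _).trans (add_le_add hA ?_)
      rw [norm_smul, norm_pow]
      gcongr
    have h2 : l⁻¹ ≤ 1 := inv_le_one_of_one_le₀ hl1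
    calc ‖S k‖ ≤ ‖B‖ * ‖D k‖ := norm_mul_le _ _
      _ ≤ l⁻¹ * (Q + R ^ 2 * 1) := by
        have : ‖D k‖ ≤ Q + R ^ 2 * 1 := h1.trans (by gcongr)
        gcongr
      _ < l⁻¹ * l := by gcongr; linarith
      _ = 1 := inv_mul_cancel₀ hl0.ne'
  have hm : ∀ k ∈ Metric.ball (0 : ℂ) R, m k = c • n₀ + B (z k) := by
    intro k hk
    have h1 : ((1 - S k) * Ring.inverse (1 - S k)) (c • n₀ + d • B n₀) = c • n₀ + d • B n₀ := by
      rw [Ring.mul_inverse_cancel _ (hunit k hk)]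
      rfl
    have h2 : m k - B (D k (m k)) = c • n₀ + d • B n₀ := h1
    rw [sub_eq_iff_eq_add] at h2
    change m k = c • n₀ + B (d • n₀ + D k (m k))
    rw [map_add, map_smul, ← add_assoc]
    exact h2
  have hmd : ∀ k ∈ Metric.ball (0 : ℂ) R, DifferentiableAt ℂ m k := by
    intro k hk
    have h1 := differentiableAt_inverse_one_sub hS (hunit k hk)
    exact h1.clm_apply (differentiableAt_const _)
  have hzd : ∀ k ∈ Metric.ball (0 : ℂ) R, DifferentiableAt ℂ z k := fun k hk =>
    (hD.differentiableAt.clm_apply (hmd k hk)).const_add _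
  have hev : ∀ {f : ℂ → (ℝ →ᵇ ℂ)} {k : ℂ} (x : ℝ), DifferentiableAt ℂ f k →
      DifferentiableAt ℂ (fun k => (Real.exp (l * |x - x₀|) : ℂ) * f k x) k := by
    intro f k x hf
    exact (((BoundedContinuousFunction.evalCLM ℂ x).differentiableAt).comp k hf).const_mul _
  have hsys : ∀ k ∈ Metric.ball (0 : ℂ) R,
      IsSolution q k (fun x => (Real.exp (l * |x - x₀|) : ℂ) * m k x) ∧
      deriv (fun x => (Real.exp (l * |x - x₀|) : ℂ) * m k x) =
        fun x => (Real.exp (l * |x - x₀|) : ℂ) * z k x := by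
    intro k hk
    have hyc : Continuous (fun x => (Real.exp (l * |x - x₀|) : ℂ) * m k x) :=
      Continuous.mul (by fun_prop) (m k).continuous
    have hzc : Continuous (fun x => (Real.exp (l * |x - x₀|) : ℂ) * z k x) :=
      Continuous.mul (by fun_prop) (z k).continuous
    refine isSolution_of_integral_system hq (x₀ := x₀) (c := c) (d := d) hyc hzc
      (fun x => ?_) (fun x => ?_)
    · rw [← hB' (z k) x]
      conv_lhs => rw [hm k hk]
      simp only [BoundedContinuousFunction.coe_add, BoundedContinuousFunction.coe_smul,
        Pi.add_apply, smul_eq_mul]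
      rw [mul_add, mul_left_comm, hn₀, mul_one]
    · have e : ∫ t in x₀..x, ((q t : ℂ) - k ^ 2) * ((Real.exp (l * |t - x₀|) : ℂ) * m k t) =
          Real.exp (l * |x - x₀|) * A (m k) x - k ^ 2 * (Real.exp (l * |x - x₀|) * B (m k) x) := by
        rw [hA', hB', ← intervalIntegral.integral_const_mul, ← intervalIntegral.integral_sub]
        · simp only [sub_mul]
        · exact (intervalIntegrable_ofReal hq _ _).mul_continuousOn hyc.continuousOn
        · exact (continuous_const.mul hyc).intervalIntegrable _ _
      rw [e]
      simp only [z, D, BoundedContinuousFunction.coe_add, BoundedContinuousFunction.coe_smul,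
        Pi.add_apply, smul_eq_mul, _root_.sub_apply, _root_.smul_apply,
        BoundedContinuousFunction.coe_sub, Pi.sub_apply]
      rw [mul_add, mul_left_comm, hn₀]
      ring
  refine ⟨fun k x => (Real.exp (l * |x - x₀|) : ℂ) * m k x, fun k hk => ?_⟩
  obtain ⟨hs1, hs2⟩ := hsys k hk
  refine ⟨hs1, ?_, ?_, fun x => ⟨hev x (hmd k hk), ?_⟩⟩
  · have := hB' (z k) x₀
    simp only [sub_self, abs_zero, mul_zero, Real.exp_zero, Complex.ofReal_one, one_mul,
      integral_same] at this
    have h0 := hn₀ x₀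
    simp only [sub_self, abs_zero, mul_zero, Real.exp_zero, Complex.ofReal_one, one_mul] at h0
    simp [hm k hk, this, h0]
  · have h1 := hA' (m k) x₀
    have h2 := hB' (m k) x₀
    simp only [sub_self, abs_zero, mul_zero, Real.exp_zero, Complex.ofReal_one, one_mul,
      integral_same] at h1 h2
    have h0 := hn₀ x₀
    simp only [sub_self, abs_zero, mul_zero, Real.exp_zero, Complex.ofReal_one, one_mul] at h0
    rw [hs2]
    simp [z, D, h1, h2, h0]
  · refine (hev x (hzd k hk)).congr_of_eventuallyEq ?_
    filter_upwards [Metric.isOpen_ball.mem_nhds hk] with k' hk'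
    rw [(hsys k' hk').2]

end

/-! ### Cauchy solutions, variation of constants and growth bounds -/

section

open Set intervalIntegral Topology

/-- The solution with Cauchy data `y x₀ = c`, `y' x₀ = d`. -/
def cauchySol (q : ℝ → ℝ) (x₀ : ℝ) (c d k : ℂ) : ℝ → ℂ :=
  Classical.epsilon fun y => IsSolution q k y ∧ y x₀ = c ∧ deriv y x₀ = d

section

variable {p q : ℝ → ℝ} {k : ℂ} {f g y : ℝ → ℂ}

lemma cauchySol_spec (hq : Integrable q) (x₀ : ℝ) (c d k : ℂ) :
    IsSolution q k (cauchySol q x₀ c d k) ∧ cauchySol q x₀ c d k x₀ = c ∧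
      deriv (cauchySol q x₀ c d k) x₀ = d := by
  obtain ⟨Y, hY⟩ := exists_solution_family hq x₀ c d (R := ‖k‖ + 1) (by positivity)
  obtain ⟨h1, h2, h3, -⟩ := hY k (by simp)
  exact Classical.epsilon_spec (p := fun y => IsSolution q k y ∧ y x₀ = c ∧ deriv y x₀ = d)
    ⟨Y k, h1, h2, h3⟩

lemma isSolution_cauchySol (hq : Integrable q) (x₀ : ℝ) (c d k : ℂ) :
    IsSolution q k (cauchySol q x₀ c d k) := (cauchySol_spec hq x₀ c d k).1

/-- Solutions with the same Cauchy data at `x₁` agree as long as the potentials do. -/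
lemma eq_of_ae_eq (hq : Integrable q) (hp : Integrable p) (hf : IsSolution q k f)
    (hg : IsSolution p k g) {x₁ x : ℝ} (h : ∀ᵐ t, t ∈ uIoc x₁ x → p t = q t)
    (h0 : f x₁ = g x₁) (h1 : deriv f x₁ = deriv g x₁) : f x = g x ∧ deriv f x = deriv g x := by
  -- Testing against the solutions with data `(1, 0)` and `(0, 1)` at `x` reads off the derivative
  -- and the value there, so uniqueness needs no Gronwall estimate.
  have key : ∀ u, IsSolution q k u → wronskian u f x = wronskian u g x := fun u hu => by
    rw [wronskian_eq hq hu hf x₁ x, wronskian_eq_of_ae_eq hq hp hu hg h, wronskian, wronskian,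
      h0, h1]
  obtain ⟨a1, a2, a3⟩ := cauchySol_spec hq x 1 0 k
  obtain ⟨b1, b2, b3⟩ := cauchySol_spec hq x 0 1 k
  have ha := key _ a1
  have hb := key _ b1
  simp only [wronskian, a2, a3, b2, b3, zero_mul, one_mul, sub_zero, zero_sub, neg_inj] at ha hb
  exact ⟨hb, ha⟩

lemma IsSolution.ext_cauchy (hq : Integrable q) (hf : IsSolution q k f) (hg : IsSolution q k g)
    (x₁ : ℝ) (h0 : f x₁ = g x₁) (h1 : deriv f x₁ = deriv g x₁) : f = g :=
  funext fun _ => (eq_of_ae_eq hq hq hf hg (Eventually.of_forall fun _ _ => rfl) h0 h1).1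

lemma IsSolution.eq_cauchySol (hq : Integrable q) (hy : IsSolution q k y) (x₀ : ℝ) :
    y = cauchySol q x₀ (y x₀) (deriv y x₀) k := by
  obtain ⟨h1, h2, h3⟩ := cauchySol_spec hq x₀ (y x₀) (deriv y x₀) k
  exact hy.ext_cauchy hq h1 x₀ h2.symm h3.symm

/-- Only `k²` enters the equation. This evenness later carries estimates from the upper half-plane
to the lower one. -/
lemma cauchySol_neg (hq : Integrable q) (x₀ : ℝ) (c d k : ℂ) :
    cauchySol q x₀ c d (-k) = cauchySol q x₀ c d k := by
  obtain ⟨h1, h2, h3⟩ := cauchySol_spec hq x₀ c d k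
  have := (h1.neg_param).eq_cauchySol hq x₀
  rw [h2, h3] at this
  exact this.symm

/-- By uniqueness the chosen solution coincides near `k` with the analytic family built on a ball.
-/
lemma cauchySol_differentiableAt (hq : Integrable q) (x₀ : ℝ) (c d k : ℂ) (x : ℝ) :
    DifferentiableAt ℂ (fun k => cauchySol q x₀ c d k x) k ∧
      DifferentiableAt ℂ (fun k => deriv (cauchySol q x₀ c d k) x) k := by
  obtain ⟨Y, hY⟩ := exists_solution_family hq x₀ c d (R := ‖k‖ + 1) (by positivity)
  have hk : k ∈ Metric.ball (0 : ℂ) (‖k‖ + 1) := by simp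
  have he : ∀ k' ∈ Metric.ball (0 : ℂ) (‖k‖ + 1), cauchySol q x₀ c d k' = Y k' := fun k' hk' => by
    obtain ⟨h1, h2, h3, -⟩ := hY k' hk'
    have := h1.eq_cauchySol hq x₀
    rw [h2, h3] at this
    exact this.symm
  have hev := Metric.isOpen_ball.mem_nhds hk
  exact ⟨((hY k hk).2.2.2 x).1.congr_of_eventuallyEq
      (eventually_of_mem hev fun k' hk' => by simp only [he k' hk']),
    ((hY k hk).2.2.2 x).2.congr_of_eventuallyEq
      (eventually_of_mem hev fun k' hk' => by simp only [he k' hk'])⟩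

lemma differentiable_cauchySol (hq : Integrable q) (x₀ : ℝ) (c d : ℂ) (x : ℝ) :
    Differentiable ℂ fun k => cauchySol q x₀ c d k x :=
  fun k => (cauchySol_differentiableAt hq x₀ c d k x).1

lemma differentiable_deriv_cauchySol (hq : Integrable q) (x₀ : ℝ) (c d : ℂ) (x : ℝ) :
    Differentiable ℂ fun k => deriv (cauchySol q x₀ c d k) x :=
  fun k => (cauchySol_differentiableAt hq x₀ c d k x).2

/-- A solution in terms of the fundamental system at `x₀`. -/
lemma IsSolution.eq_fundamental (hq : Integrable q) (hy : IsSolution q k y) (x₀ : ℝ) :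
    y = fun x => y x₀ * cauchySol q x₀ 1 0 k x + deriv y x₀ * cauchySol q x₀ 0 1 k x := by
  obtain ⟨a1, a2, a3⟩ := cauchySol_spec hq x₀ 1 0 k
  obtain ⟨b1, b2, b3⟩ := cauchySol_spec hq x₀ 0 1 k
  refine hy.ext_cauchy hq ((a1.const_mul _).add hq (b1.const_mul _)) x₀ (by simp [a2, b2]) ?_
  rw [(((a1.hasDerivAt x₀).const_mul _).fun_add ((b1.hasDerivAt x₀).const_mul _)).deriv]
  simp [a3, b3]

lemma wronskian_cauchySol (hq : Integrable q) (x₀ x : ℝ) (k : ℂ) :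
    wronskian (cauchySol q x₀ 1 0 k) (cauchySol q x₀ 0 1 k) x = 1 := by
  obtain ⟨a1, a2, a3⟩ := cauchySol_spec hq x₀ 1 0 k
  obtain ⟨b1, b2, b3⟩ := cauchySol_spec hq x₀ 0 1 k
  rw [wronskian_eq hq a1 b1 x₀ x, wronskian, a2, a3, b2, b3]
  simp

end

lemma norm_exp_I_mul_le (z : ℂ) : ‖Complex.exp (z * Complex.I)‖ ≤ Real.exp |z.im| ∧
    ‖Complex.exp (-z * Complex.I)‖ ≤ Real.exp |z.im| := by
  simp only [Complex.norm_exp]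
  refine ⟨Real.exp_le_exp.2 ?_, Real.exp_le_exp.2 ?_⟩
  · simpa using neg_le_abs z.im
  · simpa using le_abs_self z.im

lemma norm_sin_le_exp (z : ℂ) : ‖Complex.sin z‖ ≤ Real.exp |z.im| := by
  obtain ⟨h1, h2⟩ := norm_exp_I_mul_le z
  have h := norm_sub_le (Complex.exp (-z * Complex.I)) (Complex.exp (z * Complex.I))
  rw [Complex.sin, norm_div, norm_mul, Complex.norm_I, mul_one, Complex.norm_ofNat]
  linarith

lemma norm_cos_le_exp (z : ℂ) : ‖Complex.cos z‖ ≤ Real.exp |z.im| := by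
  obtain ⟨h1, h2⟩ := norm_exp_I_mul_le z
  have h := norm_add_le (Complex.exp (z * Complex.I)) (Complex.exp (-z * Complex.I))
  rw [Complex.cos, norm_div, Complex.norm_ofNat]
  linarith

lemma isSolution_free (k : ℂ) {u u' : ℝ → ℂ} (h1 : ∀ t, HasDerivAt u (u' t) t)
    (h2 : ∀ t, HasDerivAt u' (-k ^ 2 * u t) t) : IsSolution (fun _ => 0) k u ∧ deriv u = u' := by
  have hd : deriv u = u' := funext fun t => (h1 t).deriv
  refine ⟨⟨fun t => (h1 t).differentiableAt, fun x₁ x₂ => ?_⟩, hd⟩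
  rw [hd, ← integral_eq_sub_of_hasDerivAt (fun t _ => h2 t)]
  · simp
  · exact (continuous_const.mul (continuous_iff_continuousAt.2
      fun t => (h1 t).continuousAt)).intervalIntegrable _ _

lemma hasDerivAt_free_sin (k : ℂ) (x t : ℝ) :
    HasDerivAt (fun t : ℝ => Complex.sin (k * (x - t))) (-(k * Complex.cos (k * (x - t)))) t ∧
    HasDerivAt (fun t : ℝ => Complex.cos (k * (x - t))) (k * Complex.sin (k * (x - t))) t := by
  have h : HasDerivAt (fun t : ℝ => k * ((x : ℂ) - t)) (k * (0 - 1)) t :=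
    ((hasDerivAt_const t (x : ℂ)).sub Complex.ofRealCLM.hasDerivAt).const_mul k
  exact ⟨((Complex.hasDerivAt_sin _).comp t h).congr_deriv (by ring),
    ((Complex.hasDerivAt_cos _).comp t h).congr_deriv (by ring)⟩

section

variable {q : ℝ → ℝ} {k : ℂ} {y : ℝ → ℂ}

/-- Variation of constants against the free equation `-y'' = k² y`. -/
lemma IsSolution.variation_of_constants (hq : Integrable q) (hy : IsSolution q k y) (hk : k ≠ 0)
    (x₀ x : ℝ) :
    y x = Complex.cos (k * (x - x₀)) * y x₀ + Complex.sin (k * (x - x₀)) / k * deriv y x₀ +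
      ∫ t in x₀..x, q t * (Complex.sin (k * (x - t)) / k * y t) := by
  -- The free solution with value `0` and slope `-1` at `t = x`: its Wronskian with `y` at `x` is `y
  -- x`, and the Wronskian identity from `x₀` to `x` is the claim.
  obtain ⟨hs, hd⟩ := isSolution_free k (u := fun t : ℝ => Complex.sin (k * (x - t)) / k)
    (u' := fun t : ℝ => -Complex.cos (k * (x - t)))
    (fun t => ((hasDerivAt_free_sin k x t).1.div_const k).congr_deriv (by field_simp))
    (fun t => ((hasDerivAt_free_sin k x t).2.neg).congr_deriv (by field_simp))
  have h := wronskian_sub (q := fun _ => 0) (integrable_zero ℝ ℝ volume) hq hs hy x₀ x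
  simp only [wronskian, hd, sub_self, mul_zero, Complex.sin_zero, Complex.cos_zero, zero_div,
    zero_mul, neg_mul, one_mul, Complex.ofReal_zero, sub_zero,
    sub_neg_eq_add] at h
  linear_combination h

/-- `‖q‖₁` -/
def potNorm (q : ℝ → ℝ) : ℝ := ∫ t, |q t|

lemma potNorm_nonneg (q : ℝ → ℝ) : 0 ≤ potNorm q := integral_nonneg fun _ => abs_nonneg _

lemma integral_abs_le_potNorm (hq : Integrable q) (a b : ℝ) :
    |∫ t in a..b, (|q t|)| ≤ potNorm q := by
  rw [abs_integral_eq_abs_integral_uIoc, abs_of_nonneg (setIntegral_nonneg measurableSet_uIoc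
    fun t _ => abs_nonneg _)]
  exact setIntegral_le_integral hq.abs (Eventually.of_forall fun _ => abs_nonneg _)

lemma norm_integral_mul_le_potNorm (hq : Integrable q) {a b C : ℝ} (hC : 0 ≤ C) {u : ℝ → ℂ}
    (hu : ∀ t ∈ uIoc a b, ‖u t‖ ≤ C) : ‖∫ t in a..b, q t * u t‖ ≤ C * potNorm q := by
  have h : ‖∫ t in a..b, q t * u t‖ ≤ |∫ t in a..b, (C * |q t|)| := by
    refine norm_integral_le_abs_of_norm_le ?_ (hq.abs.intervalIntegrable.const_mul _)
    refine (ae_restrict_iff' measurableSet_uIoc).2 (Eventually.of_forall fun t ht => ?_)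
    rw [norm_mul, Complex.norm_real, Real.norm_eq_abs, mul_comm]
    gcongr
    exact hu t ht
  rw [intervalIntegral.integral_const_mul, abs_mul, abs_of_nonneg hC] at h
  exact h.trans (by gcongr; exact integral_abs_le_potNorm hq a b)

lemma abs_sub_add_abs_sub_of_mem_uIcc {x₀ x t : ℝ} (ht : t ∈ uIcc x₀ x) :
    |x - t| + |t - x₀| = |x - x₀| := by
  rcases le_total x₀ x with h | h
  · rw [uIcc_of_le h] at ht
    rw [abs_of_nonneg (by linarith [ht.2]), abs_of_nonneg (by linarith [ht.1]),
      abs_of_nonneg (by linarith)]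
    ring
  · rw [uIcc_of_ge h] at ht
    rw [abs_of_nonpos (by linarith [ht.1]), abs_of_nonpos (by linarith [ht.2]),
      abs_of_nonpos (by linarith)]
    ring

lemma abs_im_mul_ofReal (k : ℂ) (s : ℝ) : |(k * s).im| = |k.im| * |s| := by
  simp [abs_mul]

/-- For large `k` a solution grows no faster than the free one. -/
lemma IsSolution.norm_le (hq : Integrable q) (hy : IsSolution q k y) (hk : k ≠ 0)
    (hkq : 2 * potNorm q ≤ ‖k‖) (x₀ x : ℝ) :
    ‖y x‖ ≤ 2 * (‖y x₀‖ + ‖deriv y x₀‖ / ‖k‖) * Real.exp (|k.im| * |x - x₀|) := by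
  have hk0 : 0 < ‖k‖ := norm_pos_iff.2 hk
  set c := ‖y x₀‖ + ‖deriv y x₀‖ / ‖k‖ with hc
  set w : ℝ → ℝ := fun t => Real.exp (-(|k.im| * |t - x₀|)) * ‖y t‖ with hw
  have hwc : Continuous w := by
    have := hy.continuous
    fun_prop
  -- At a maximum `s` of the weighted modulus, variation of constants gives `w s ≤ c + w s / 2`, the
  -- half coming from `potNorm q / ‖k‖ ≤ 1 / 2`. The integral term is absorbed.
  obtain ⟨s, hs, hmax⟩ := isCompact_uIcc.exists_isMaxOn (nonempty_uIcc (a := x₀) (b := x))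
    hwc.continuousOn
  have hyw : ∀ t, ‖y t‖ = Real.exp (|k.im| * |t - x₀|) * w t := fun t => by
    simp only [hw]
    rw [← mul_assoc, ← Real.exp_add]
    simp
  have hw0 : 0 ≤ w s := by positivity
  have hsin : ∀ t : ℝ, ‖Complex.sin (k * (s - t)) / k‖ ≤ Real.exp (|k.im| * |s - t|) / ‖k‖ := by
    intro t
    rw [norm_div]
    gcongr
    rw [← abs_im_mul_ofReal]
    push_cast
    exact norm_sin_le_exp _
  have hcos : ‖Complex.cos (k * (s - x₀))‖ ≤ Real.exp (|k.im| * |s - x₀|) := by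
    rw [← abs_im_mul_ofReal]
    push_cast
    exact norm_cos_le_exp _
  have hint : ‖∫ t in x₀..s, q t * (Complex.sin (k * (s - t)) / k * y t)‖ ≤
      (Real.exp (|k.im| * |s - x₀|) / ‖k‖ * w s) * potNorm q := by
    refine norm_integral_mul_le_potNorm hq (by positivity) fun t ht => ?_
    have ht' := uIoc_subset_uIcc ht
    have hwt : w t ≤ w s := hmax (uIcc_subset_uIcc_left hs ht')
    rw [norm_mul, hyw t]
    calc ‖Complex.sin (k * (s - t)) / k‖ * (Real.exp (|k.im| * |t - x₀|) * w t)
        ≤ Real.exp (|k.im| * |s - t|) / ‖k‖ * (Real.exp (|k.im| * |t - x₀|) * w s) := by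
          gcongr
          exact hsin t
      _ = (Real.exp (|k.im| * |s - t|) * Real.exp (|k.im| * |t - x₀|)) / ‖k‖ * w s := by ring
      _ = _ := by
        rw [← Real.exp_add, ← mul_add, abs_sub_add_abs_sub_of_mem_uIcc ht']
  have hys : ‖y s‖ ≤ Real.exp (|k.im| * |s - x₀|) * (c + w s / 2) := by
    rw [hy.variation_of_constants hq hk x₀ s]
    have e1 : ‖Complex.cos (k * (s - x₀)) * y x₀‖ ≤ Real.exp (|k.im| * |s - x₀|) * ‖y x₀‖ := by
      rw [norm_mul]
      gcongr
    have e2 : ‖Complex.sin (k * (s - x₀)) / k * deriv y x₀‖ ≤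
        Real.exp (|k.im| * |s - x₀|) / ‖k‖ * ‖deriv y x₀‖ := by
      rw [norm_mul]
      gcongr
      exact hsin x₀
    have e3 : (Real.exp (|k.im| * |s - x₀|) / ‖k‖ * w s) * potNorm q ≤
        Real.exp (|k.im| * |s - x₀|) * (w s / 2) := by
      have : potNorm q / ‖k‖ ≤ 1 / 2 := by
        rw [div_le_iff₀ hk0]
        linarith
      calc (Real.exp (|k.im| * |s - x₀|) / ‖k‖ * w s) * potNorm q
          = Real.exp (|k.im| * |s - x₀|) * (w s * (potNorm q / ‖k‖)) := by ring
        _ ≤ Real.exp (|k.im| * |s - x₀|) * (w s * (1 / 2)) := by gcongr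
        _ = _ := by ring
    refine (norm_add₃_le.trans (add_le_add (add_le_add e1 e2) (hint.trans e3))).trans_eq ?_
    rw [hc]
    ring
  have hws : w s ≤ 2 * c := by
    rw [hyw s] at hys
    have := le_of_mul_le_mul_left hys (Real.exp_pos _)
    linarith
  rw [hyw x, mul_comm]
  have : w x ≤ w s := hmax right_mem_uIcc
  gcongr
  linarith

end

end

/-! ### Jost solutions and their asymptotics -/

section

open Set intervalIntegral Topology

/-- Oriented to fit `eq_of_ae_eq` with the zero potential in second place. -/
lemma Q1.ae_zero_right {q : ℝ → ℝ} (hq : Q1 q) {x : ℝ} (hx : 1 ≤ x) :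
    ∀ᵐ t, t ∈ uIoc 1 x → 0 = q t := by
  filter_upwards [hq.support] with t ht htm
  rw [uIoc_of_le hx] at htm
  exact (ht fun h => absurd h.2 (not_le.2 htm.1)).symm

lemma Q1.ae_zero_left {q : ℝ → ℝ} (hq : Q1 q) {x : ℝ} (hx : x ≤ 0) :
    ∀ᵐ t, t ∈ uIoc 0 x → 0 = q t := by
  have h0 : ∀ᵐ t : ℝ, t ≠ 0 := by simp [ae_iff, measure_singleton]
  filter_upwards [hq.support, h0] with t ht h0 htm
  rw [uIoc_of_ge hx] at htm
  exact (ht fun h => h0 (le_antisymm htm.2 h.1)).symm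

lemma hasDerivAt_cexp_mul (c : ℂ) (t : ℝ) :
    HasDerivAt (fun t : ℝ => Complex.exp (c * t)) (c * Complex.exp (c * t)) t :=
  ((Complex.hasDerivAt_exp _).comp t (Complex.ofRealCLM.hasDerivAt.const_mul c)).congr_deriv
    (by simp [mul_comm])

lemma isSolution_cexp {k c : ℂ} (hc : c ^ 2 = -k ^ 2) :
    IsSolution (fun _ => 0) k (fun t : ℝ => Complex.exp (c * t)) ∧
      deriv (fun t : ℝ => Complex.exp (c * t)) = fun t : ℝ => c * Complex.exp (c * t) :=
  isSolution_free k (hasDerivAt_cexp_mul c) fun t =>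
    ((hasDerivAt_cexp_mul c t).const_mul c).congr_deriv (by rw [← hc]; ring)

lemma deriv_eq_of_eqOn_right {y u : ℝ → ℂ} {x : ℝ} (hy : DifferentiableAt ℝ y x)
    (hu : DifferentiableAt ℝ u x) (h : EqOn y u (Ici x)) : deriv y x = deriv u x :=
  (uniqueDiffOn_Ici x x self_mem_Ici).eq_deriv _ hy.hasDerivAt.hasDerivWithinAt
    (hu.hasDerivAt.hasDerivWithinAt.congr h (h self_mem_Ici))

lemma deriv_eq_of_eqOn_left {y u : ℝ → ℂ} {x : ℝ} (hy : DifferentiableAt ℝ y x)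
    (hu : DifferentiableAt ℝ u x) (h : EqOn y u (Iic x)) : deriv y x = deriv u x :=
  (uniqueDiffOn_Iic x x self_mem_Iic).eq_deriv _ hy.hasDerivAt.hasDerivWithinAt
    (hu.hasDerivAt.hasDerivWithinAt.congr h (h self_mem_Iic))

section

variable {p q : ℝ → ℝ} {k : ℂ}

/-- The solution with the Cauchy data of `e^{ikx}` at `1` stays equal to it to the right, where the
potential vanishes. -/
lemma jostPlus_spec (hq : Q1 q) (k : ℂ) : IsJostPlus q k (jostPlus q k) := by
  refine Classical.epsilon_spec (p := IsJostPlus q k) ?_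
  obtain ⟨hu, hu'⟩ := isSolution_cexp (k := k) (c := Complex.I * k)
    (by rw [mul_pow, Complex.I_sq]; ring)
  obtain ⟨h1, h2, h3⟩ := cauchySol_spec hq.integrable 1 (Complex.exp (Complex.I * k * (1 : ℝ)))
    (Complex.I * k * Complex.exp (Complex.I * k * (1 : ℝ))) k
  refine ⟨_, h1, fun x hx => (eq_of_ae_eq hq.integrable (integrable_zero ℝ ℝ volume) h1 hu
    (hq.ae_zero_right hx) h2 ?_).1⟩
  rw [h3, hu']

lemma jostMinus_spec (hq : Q1 q) (k : ℂ) : IsJostMinus q k (jostMinus q k) := by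
  refine Classical.epsilon_spec (p := IsJostMinus q k) ?_
  obtain ⟨hu, hu'⟩ := isSolution_cexp (k := k) (c := -(Complex.I * k))
    (by rw [neg_sq, mul_pow, Complex.I_sq]; ring)
  obtain ⟨h1, h2, h3⟩ := cauchySol_spec hq.integrable 0 1 (-(Complex.I * k)) k
  refine ⟨_, h1, fun x hx => ?_⟩
  rw [(eq_of_ae_eq hq.integrable (integrable_zero ℝ ℝ volume) h1 hu
    (hq.ae_zero_left hx) (by simp [h2]) (by rw [h3, hu']; simp)).1, neg_mul]

lemma isSolution_jostPlus (hq : Q1 q) (k : ℂ) : IsSolution q k (jostPlus q k) :=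
  (jostPlus_spec hq k).1

lemma isSolution_jostMinus (hq : Q1 q) (k : ℂ) : IsSolution q k (jostMinus q k) :=
  (jostMinus_spec hq k).1

lemma jostPlus_one (hq : Q1 q) (k : ℂ) : jostPlus q k 1 = Complex.exp (Complex.I * k) := by
  simpa using (jostPlus_spec hq k).2 1 le_rfl

lemma deriv_jostPlus_one (hq : Q1 q) (k : ℂ) :
    deriv (jostPlus q k) 1 = Complex.I * k * Complex.exp (Complex.I * k) := by
  rw [deriv_eq_of_eqOn_right ((isSolution_jostPlus hq k).differentiable 1)
    (hasDerivAt_cexp_mul (Complex.I * k) 1).differentiableAt (fun x hx => (jostPlus_spec hq k).2 x hx),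
    (hasDerivAt_cexp_mul _ _).deriv]
  simp

lemma jostMinus_zero (hq : Q1 q) (k : ℂ) : jostMinus q k 0 = 1 := by
  simpa using (jostMinus_spec hq k).2 0 le_rfl

lemma deriv_jostMinus_zero (hq : Q1 q) (k : ℂ) :
    deriv (jostMinus q k) 0 = -(Complex.I * k) := by
  rw [deriv_eq_of_eqOn_left ((isSolution_jostMinus hq k).differentiable 0)
    (hasDerivAt_cexp_mul (-(Complex.I * k)) 0).differentiableAt
    (fun x hx => ((jostMinus_spec hq k).2 x hx).trans (by rw [neg_mul])),
    (hasDerivAt_cexp_mul _ _).deriv]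
  simp

/-- Solutions whose Cauchy data are entire in `k` are entire in `k`. -/
lemma differentiable_of_cauchy_data (hq : Integrable q) {Y : ℂ → ℝ → ℂ}
    (hY : ∀ k, IsSolution q k (Y k)) {x₀ : ℝ} (h0 : Differentiable ℂ fun k => Y k x₀)
    (h1 : Differentiable ℂ fun k => deriv (Y k) x₀) (x : ℝ) :
    Differentiable ℂ (fun k => Y k x) ∧ Differentiable ℂ fun k => deriv (Y k) x := by
  constructor
  · rw [show (fun k => Y k x) = fun k => Y k x₀ * cauchySol q x₀ 1 0 k x +
      deriv (Y k) x₀ * cauchySol q x₀ 0 1 k x from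
      funext fun k => congrFun ((hY k).eq_fundamental hq x₀) x]
    exact (h0.mul (differentiable_cauchySol hq x₀ 1 0 x)).add
      (h1.mul (differentiable_cauchySol hq x₀ 0 1 x))
  · have : (fun k => deriv (Y k) x) = fun k => Y k x₀ * deriv (cauchySol q x₀ 1 0 k) x +
        deriv (Y k) x₀ * deriv (cauchySol q x₀ 0 1 k) x := funext fun k => by
      conv_lhs => rw [(hY k).eq_fundamental hq x₀]
      exact ((((isSolution_cauchySol hq x₀ 1 0 k).hasDerivAt x).const_mul _).fun_add
        (((isSolution_cauchySol hq x₀ 0 1 k).hasDerivAt x).const_mul _)).deriv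
    rw [this]
    exact (h0.mul (differentiable_deriv_cauchySol hq x₀ 1 0 x)).add
      (h1.mul (differentiable_deriv_cauchySol hq x₀ 0 1 x))

lemma differentiable_jostPlus (hq : Q1 q) (x : ℝ) :
    Differentiable ℂ (fun k => jostPlus q k x) ∧
      Differentiable ℂ fun k => deriv (jostPlus q k) x := by
  refine differentiable_of_cauchy_data hq.integrable (isSolution_jostPlus hq) (x₀ := 1) ?_ ?_ x
  · simp only [jostPlus_one hq]
    fun_prop
  · simp only [deriv_jostPlus_one hq]
    fun_prop

lemma differentiable_jostMinus (hq : Q1 q) (x : ℝ) :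
    Differentiable ℂ (fun k => jostMinus q k x) ∧
      Differentiable ℂ fun k => deriv (jostMinus q k) x := by
  refine differentiable_of_cauchy_data hq.integrable (isSolution_jostMinus hq) (x₀ := 0) ?_ ?_ x
  · simp only [jostMinus_zero hq]
    fun_prop
  · simp only [deriv_jostMinus_zero hq]
    fun_prop

lemma omega_eq (hq : Q1 q) (k : ℂ) (x : ℝ) :
    omega q k = wronskian (jostMinus q k) (jostPlus q k) x :=
  wronskian_eq hq.integrable (isSolution_jostMinus hq k) (isSolution_jostPlus hq k) x 0

lemma differentiable_omega (hq : Q1 q) : Differentiable ℂ (omega q) :=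
  ((differentiable_jostMinus hq 0).1.mul (differentiable_jostPlus hq 0).2).sub
    ((differentiable_jostMinus hq 0).2.mul (differentiable_jostPlus hq 0).1)

lemma norm_exp_I_mul (k : ℂ) : ‖Complex.exp (Complex.I * k)‖ = Real.exp (-k.im) := by
  rw [Complex.norm_exp]
  simp

lemma norm_jostPlus_le (hq : Q1 q) (hk : k ≠ 0) (hkq : 2 * potNorm q ≤ ‖k‖) (x : ℝ) :
    ‖jostPlus q k x‖ ≤ 4 * Real.exp (-k.im) * Real.exp (|k.im| * |x - 1|) := by
  refine ((isSolution_jostPlus hq k).norm_le hq.integrable hk hkq 1 x).trans_eq ?_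
  have : ‖k‖ ≠ 0 := norm_ne_zero_iff.2 hk
  rw [jostPlus_one hq, deriv_jostPlus_one hq, norm_mul, norm_mul, norm_exp_I_mul, Complex.norm_I]
  field_simp
  ring

/-- Variation of constants from `1` writes the solution as `e^{ikx}` plus an error of relative size
`4 potNorm q / ‖k‖ ≤ 1 / 2`. The bound allows division by the Jost solution at `a`. -/
lemma le_norm_jostPlus (hq : Q1 q) (hk : k ≠ 0) (hkq : 8 * potNorm q ≤ ‖k‖) (him : 0 ≤ k.im)
    {x : ℝ} (hx : x ≤ 1) : Real.exp (-(k.im * x)) / 2 ≤ ‖jostPlus q k x‖ := by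
  have hk0 : 0 < ‖k‖ := norm_pos_iff.2 hk
  have hq0 := potNorm_nonneg q
  have h := (isSolution_jostPlus hq k).variation_of_constants hq.integrable hk 1 x
  rw [jostPlus_one hq, deriv_jostPlus_one hq] at h
  have hfree : Complex.cos (k * (x - (1 : ℝ))) * Complex.exp (Complex.I * k) +
      Complex.sin (k * (x - (1 : ℝ))) / k * (Complex.I * k * Complex.exp (Complex.I * k)) =
      Complex.exp (Complex.I * (k * x)) := by
    have e : Complex.I * (k * x) = k * (x - (1 : ℝ)) * Complex.I + Complex.I * k := by
      push_cast
      ring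
    rw [e, Complex.exp_add, Complex.exp_mul_I]
    field_simp
  rw [hfree] at h
  have hint : ‖∫ t in (1 : ℝ)..x, q t * (Complex.sin (k * (x - t)) / k * jostPlus q k t)‖ ≤
      4 * Real.exp (-(k.im * x)) / ‖k‖ * potNorm q := by
    refine norm_integral_mul_le_potNorm hq.integrable (by positivity) fun t ht => ?_
    rw [uIoc_of_ge hx] at ht
    have hs : ‖Complex.sin (k * (x - t))‖ ≤ Real.exp (k.im * (t - x)) := by
      have h1 := norm_sin_le_exp (k * ((x - t : ℝ) : ℂ))
      rw [abs_im_mul_ofReal, abs_of_nonneg him, abs_sub_comm, abs_of_pos (by linarith [ht.1])] at h1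
      push_cast at h1
      exact h1
    have hj := norm_jostPlus_le hq hk (by linarith) t
    rw [abs_of_nonneg him, abs_sub_comm, abs_of_nonneg (by linarith [ht.2])] at hj
    rw [norm_mul, norm_div]
    calc ‖Complex.sin (k * (x - t))‖ / ‖k‖ * ‖jostPlus q k t‖
        ≤ Real.exp (k.im * (t - x)) / ‖k‖ *
          (4 * Real.exp (-k.im) * Real.exp (k.im * (1 - t))) := by gcongr
      _ = 4 * (Real.exp (k.im * (t - x)) * Real.exp (-k.im) * Real.exp (k.im * (1 - t))) / ‖k‖ := by
        ring
      _ = _ := by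
        rw [← Real.exp_add, ← Real.exp_add]
        ring_nf
  have hle : 4 * Real.exp (-(k.im * x)) / ‖k‖ * potNorm q ≤ Real.exp (-(k.im * x)) / 2 := by
    have : potNorm q / ‖k‖ ≤ 1 / 8 := by
      rw [div_le_iff₀ hk0]
      linarith
    calc 4 * Real.exp (-(k.im * x)) / ‖k‖ * potNorm q
        = 4 * Real.exp (-(k.im * x)) * (potNorm q / ‖k‖) := by ring
      _ ≤ 4 * Real.exp (-(k.im * x)) * (1 / 8) := by gcongr
      _ = _ := by ring
  have hn : ‖Complex.exp (Complex.I * (k * x))‖ = Real.exp (-(k.im * x)) := by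
    rw [norm_exp_I_mul]
    simp
  have := norm_sub_le_norm_add (Complex.exp (Complex.I * (k * x)))
    (∫ t in (1 : ℝ)..x, q t * (Complex.sin (k * (x - t)) / k * jostPlus q k t))
  rw [← h, hn] at this
  linarith

end

end

/-! ### Local Borg–Marchenko uniqueness -/

section

open Set intervalIntegral Topology

lemma ae_eq_zero_of_integral_eq_zero {f : ℝ → ℂ} {a b : ℝ} (hf : IntervalIntegrable f volume a b)
    (hab : a ≤ b) (h : ∀ x ∈ Icc a b, ∫ t in a..x, f t = 0) :
    ∀ᵐ x, x ∈ Icc a b → f x = 0 := by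
  have ha : ∀ᵐ x : ℝ, x ≠ a := by simp [ae_iff, measure_singleton]
  have hb : ∀ᵐ x : ℝ, x ≠ b := by simp [ae_iff, measure_singleton]
  filter_upwards [hf.ae_hasDerivAt_integral, ha, hb] with x hx hxa hxb hxm
  have h1 := hx (by rwa [uIcc_of_le hab]) a (by simp)
  have h2 : HasDerivAt (fun x => ∫ t in a..x, f t) 0 x := by
    refine (hasDerivAt_const x (0 : ℂ)).congr_of_eventuallyEq ?_
    filter_upwards [Ioo_mem_nhds (lt_of_le_of_ne hxm.1 (Ne.symm hxa)) (lt_of_le_of_ne hxm.2 hxb)]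
      with y hy using h y (Ioo_subset_Icc_self hy)
  exact h1.unique h2

lemma deriv_eq_of_eqOn_Icc {f g : ℝ → ℂ} {a b x : ℝ} (hab : a < b) (hx : x ∈ Icc a b)
    (hf : DifferentiableAt ℝ f x) (hg : DifferentiableAt ℝ g x) (h : EqOn f g (Icc a b)) :
    deriv f x = deriv g x :=
  (uniqueDiffOn_Icc hab x hx).eq_deriv _ hf.hasDerivAt.hasDerivWithinAt
    (hg.hasDerivAt.hasDerivWithinAt.congr h (h hx))

section

variable {p q : ℝ → ℝ}

/-- The decay `exp (-x Im k)` of the Jost solution offsets the growth `exp ((x - a) Im k) / ‖k‖` of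
the other factor, leaving `exp (-a Im k) / ‖k‖`, which the lower bound at `a` controls. -/
lemma norm_jostPlus_mul_cauchySol_le (hq : Q1 q) (hp : Q1 p) {a x : ℝ} (hax : a ≤ x) (hx : x ≤ 1)
    {k : ℂ} (hk : k ≠ 0) (hkq : 8 * potNorm q ≤ ‖k‖) (hkp : 8 * potNorm p ≤ ‖k‖)
    (him : 0 ≤ k.im) :
    ‖jostPlus q k x‖ * ‖cauchySol p a 0 1 k x‖ ≤ 16 / ‖k‖ * ‖jostPlus q k a‖ := by
  have hq0 := potNorm_nonneg q
  have hp0 := potNorm_nonneg p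
  obtain ⟨s1, s2, s3⟩ := cauchySol_spec hp.integrable a 0 1 k
  have h1 := s1.norm_le hp.integrable hk (by linarith) a x
  have h2 := norm_jostPlus_le hq hk (by linarith) x
  have h3 := le_norm_jostPlus hq hk hkq him (hax.trans hx)
  rw [s2, s3, abs_of_nonneg him, abs_of_nonneg (by linarith), norm_zero, norm_one, zero_add] at h1
  rw [abs_of_nonneg him, abs_sub_comm, abs_of_nonneg (by linarith)] at h2
  calc ‖jostPlus q k x‖ * ‖cauchySol p a 0 1 k x‖
      ≤ (4 * Real.exp (-k.im) * Real.exp (k.im * (1 - x))) *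
        (2 * (1 / ‖k‖) * Real.exp (k.im * (x - a))) := by gcongr
    _ = 8 / ‖k‖ * (Real.exp (-k.im) * Real.exp (k.im * (1 - x)) * Real.exp (k.im * (x - a))) := by
      ring
    _ = 16 / ‖k‖ * (Real.exp (-(k.im * a)) / 2) := by
      rw [← Real.exp_add, ← Real.exp_add]
      ring_nf
    _ ≤ _ := by gcongr

/-- If the Jost solutions of two potentials are proportional at `a`, then so are, at each point of
`[a, 1]`, the fundamental systems with data at `a`. -/
lemma fundamental_proportional (hq : Q1 q) (hp : Q1 p) {a : ℝ}
    (hW : ∀ k, wronskian (jostPlus q k) (jostPlus p k) a = 0) {x : ℝ} (hax : a ≤ x) (hx : x ≤ 1)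
    (k : ℂ) :
    cauchySol q a 1 0 k x * cauchySol p a 0 1 k x =
      cauchySol p a 1 0 k x * cauchySol q a 0 1 k x := by
  set g : ℂ → ℂ := fun k => cauchySol q a 1 0 k x * cauchySol p a 0 1 k x -
      cauchySol p a 1 0 k x * cauchySol q a 0 1 k x with hg
  have hgd : Differentiable ℂ g :=
    ((differentiable_cauchySol hq.integrable a 1 0 x).mul
      (differentiable_cauchySol hp.integrable a 0 1 x)).sub
    ((differentiable_cauchySol hp.integrable a 1 0 x).mul
      (differentiable_cauchySol hq.integrable a 0 1 x))
  have hup : ∀ k : ℂ, k ≠ 0 → 8 * potNorm q ≤ ‖k‖ → 8 * potNorm p ≤ ‖k‖ → 0 ≤ k.im →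
      ‖g k‖ ≤ 32 / ‖k‖ := by
    intro k hk hkq hkp him
    have e1 := congrFun ((isSolution_jostPlus hq k).eq_fundamental hq.integrable a) x
    have e2 := congrFun ((isSolution_jostPlus hp k).eq_fundamental hp.integrable a) x
    have e3 := hW k
    rw [wronskian] at e3
    -- Expanding both Jost solutions in the fundamental systems at `a` leaves a product of the two
    -- sine-type solutions, whose coefficient is the vanishing Wronskian.
    have e : jostPlus q k a * jostPlus p k a * g k =
        jostPlus p k a * (jostPlus q k x * cauchySol p a 0 1 k x) -
        jostPlus q k a * (jostPlus p k x * cauchySol q a 0 1 k x) := by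
      rw [e1, e2]
      simp only [hg]
      linear_combination cauchySol q a 0 1 k x * cauchySol p a 0 1 k x * e3
    have hA : 0 < ‖jostPlus q k a‖ :=
      (by positivity : (0 : ℝ) < _).trans_le (le_norm_jostPlus hq hk hkq him (hax.trans hx))
    have hB : 0 < ‖jostPlus p k a‖ :=
      (by positivity : (0 : ℝ) < _).trans_le (le_norm_jostPlus hp hk hkp him (hax.trans hx))
    have h1 := norm_jostPlus_mul_cauchySol_le hq hp hax hx hk hkq hkp him
    have h2 := norm_jostPlus_mul_cauchySol_le hp hq hax hx hk hkp hkq him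
    have h3 : ‖jostPlus q k a‖ * ‖jostPlus p k a‖ * ‖g k‖ ≤
        ‖jostPlus q k a‖ * ‖jostPlus p k a‖ * (32 / ‖k‖) := by
      rw [← norm_mul, ← norm_mul, e]
      refine (norm_sub_le _ _).trans ?_
      simp only [norm_mul]
      calc _ ≤ ‖jostPlus p k a‖ * (16 / ‖k‖ * ‖jostPlus q k a‖) +
            ‖jostPlus q k a‖ * (16 / ‖k‖ * ‖jostPlus p k a‖) := by gcongr
        _ = _ := by ring
    exact le_of_mul_le_mul_left h3 (by positivity)
  -- The Jost bounds give decay for `Im k ≥ 0` only; evenness supplies the other half-plane, and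
  -- Liouville applies.
  have hneg : ∀ k, g (-k) = g k := fun k => by
    simp only [hg, cauchySol_neg hq.integrable, cauchySol_neg hp.integrable]
  have hall : ∀ᶠ k in cocompact ℂ, ‖g k‖ ≤ 32 / ‖k‖ := by
    filter_upwards [(tendsto_norm_cocompact_atTop (E := ℂ)).eventually_gt_atTop 0,
      (tendsto_norm_cocompact_atTop (E := ℂ)).eventually_ge_atTop (8 * potNorm q),
      (tendsto_norm_cocompact_atTop (E := ℂ)).eventually_ge_atTop (8 * potNorm p)] with k h0 h1 h2
    rcases le_total 0 k.im with him | him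
    · exact hup k (norm_pos_iff.1 h0) h1 h2 him
    · rw [← hneg, ← norm_neg k]
      exact hup (-k) (neg_ne_zero.2 (norm_pos_iff.1 h0)) (by rwa [norm_neg]) (by rwa [norm_neg])
        (by simpa using him)
  have hlim : Tendsto g (cocompact ℂ) (𝓝 0) :=
    squeeze_zero_norm' hall (tendsto_norm_cocompact_atTop.const_div_atTop 32)
  exact sub_eq_zero.1 (hgd.apply_eq_of_tendsto_cocompact k hlim)

/-- Subtracting the two equations gives this product. The factor `u` may vanish, so a second
solution with nonzero Wronskian is needed to conclude that the potentials agree. -/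
lemma ae_mul_eq_zero_of_eqOn (hq : Integrable q) (hp : Integrable p) {a b : ℝ} (hab : a < b)
    {k : ℂ} {u v : ℝ → ℂ} (hu : IsSolution q k u) (hv : IsSolution p k v)
    (h : EqOn u v (Icc a b)) : ∀ᵐ x, x ∈ Icc a b → ((p x : ℂ) - q x) * u x = 0 := by
  have i1 := intervalIntegrable_potential_mul hq k hu.continuous
  have i2 := intervalIntegrable_potential_mul hp k hv.continuous
  have hd : ∀ x ∈ Icc a b, deriv u x = deriv v x := fun x hx =>
    deriv_eq_of_eqOn_Icc hab hx (hu.differentiable x) (hv.differentiable x) h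
  filter_upwards [ae_eq_zero_of_integral_eq_zero ((i2 a b).sub (i1 a b)) hab.le fun x hx => by
    rw [intervalIntegral.integral_sub (i2 a x) (i1 a x), ← hu.deriv_sub, ← hv.deriv_sub, hd x hx,
      hd a (left_mem_Icc.2 hab.le), sub_self]] with x hx hxm
  have := hx hxm
  rw [← h hxm] at this
  linear_combination this

/-- Two potentials whose fundamental systems are proportional on `[a, b]` agree there. -/
lemma ae_eq_of_fundamental_proportional (hq : Integrable q) (hp : Integrable p) {a b : ℝ}
    (hab : a < b) (k : ℂ)
    (h : ∀ x ∈ Icc a b, cauchySol q a 1 0 k x * cauchySol p a 0 1 k x =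
      cauchySol p a 1 0 k x * cauchySol q a 0 1 k x) :
    ∀ᵐ x, x ∈ Icc a b → p x = q x := by
  obtain ⟨t1, t10, t11⟩ := cauchySol_spec hq a 1 0 k
  obtain ⟨f1, f10, f11⟩ := cauchySol_spec hq a 0 1 k
  obtain ⟨t2, t20, t21⟩ := cauchySol_spec hp a 1 0 k
  obtain ⟨f2, f20, f21⟩ := cauchySol_spec hp a 0 1 k
  have w1 := fun x => wronskian_cauchySol hq a x k
  have w2 := fun x => wronskian_cauchySol hp a x k
  simp only [wronskian] at w1 w2
  set θ₁ := cauchySol q a 1 0 k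
  set φ₁ := cauchySol q a 0 1 k
  set θ₂ := cauchySol p a 1 0 k
  set φ₂ := cauchySol p a 0 1 k
  -- Heuristically `H` is the proportionality factor of the two systems, written without division.
  -- The unit Wronskians force `H² = 1`, and continuity with `H a = 1` excludes the sign `-1`.
  set H : ℝ → ℂ := fun x => θ₁ x * deriv φ₂ x - φ₁ x * deriv θ₂ x with hH
  have hHc : Continuous H := (t1.continuous.mul (f2.continuous_deriv hp)).sub
    (f1.continuous.mul (t2.continuous_deriv hp))
  have hd : ∀ x ∈ Icc a b, deriv θ₁ x * φ₂ x + θ₁ x * deriv φ₂ x =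
      deriv θ₂ x * φ₁ x + θ₂ x * deriv φ₁ x := fun x hx => by
    have e1 := (t1.hasDerivAt x).fun_mul (f2.hasDerivAt x)
    have e2 := (t2.hasDerivAt x).fun_mul (f1.hasDerivAt x)
    rw [← e1.deriv, ← e2.deriv]
    exact deriv_eq_of_eqOn_Icc hab hx e1.differentiableAt e2.differentiableAt h
  have hsq : EqOn (H ^ 2) ((fun _ => 1 : ℝ → ℂ) ^ 2) (Icc a b) := fun x hx => by
    simp only [Pi.pow_apply, hH, one_pow]
    linear_combination (-(θ₁ x * deriv φ₂ x - φ₁ x * deriv θ₂ x)) * hd x hx * (-1) -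
      (deriv θ₁ x * deriv φ₂ x - deriv θ₂ x * deriv φ₁ x) * h x hx +
      (θ₂ x * deriv φ₂ x - deriv θ₂ x * φ₂ x) * w1 x + w2 x
  have hH1 : ∀ x ∈ Icc a b, H x = 1 := by
    have hHa : H a = 1 := by simp [hH, t10, f10, f21]
    rcases isPreconnected_Icc.eq_or_eq_neg_of_sq_eq hHc.continuousOn continuousOn_const hsq
      (fun _ => one_ne_zero) with h1 | h1
    · exact h1
    · have := h1 (left_mem_Icc.2 hab.le)
      rw [hHa] at this
      norm_num at this
  have hθ : EqOn θ₁ θ₂ (Icc a b) := fun x hx => by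
    have := hH1 x hx
    simp only [hH] at this
    linear_combination θ₂ x * this - deriv θ₂ x * h x hx - θ₁ x * w2 x
  have hφ : EqOn φ₁ φ₂ (Icc a b) := fun x hx => by
    have := hH1 x hx
    simp only [hH] at this
    linear_combination φ₂ x * this - deriv φ₂ x * h x hx - φ₁ x * w2 x
  filter_upwards [ae_mul_eq_zero_of_eqOn hq hp hab t1 t2 hθ, ae_mul_eq_zero_of_eqOn hq hp hab f1 f2 hφ]
    with x h1 h2 hx
  have : (p x : ℂ) - q x = 0 := by
    linear_combination deriv φ₁ x * h1 hx - deriv θ₁ x * h2 hx - ((p x : ℂ) - q x) * w1 x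
  exact_mod_cast sub_eq_zero.1 this

/-- Local Borg–Marchenko uniqueness: the Jost solution at `a`, up to proportionality and for all
`k`, determines the potential on `[a, 1]`. -/
theorem ae_eq_of_wronskian_jostPlus_eq_zero (hq : Q1 q) (hp : Q1 p) {a : ℝ} (ha : a ≤ 1)
    (hW : ∀ k, wronskian (jostPlus q k) (jostPlus p k) a = 0) :
    ∀ᵐ x, x ∈ Icc a 1 → p x = q x := by
  rcases ha.lt_or_eq with ha | rfl
  -- All `k` were needed for Liouville's theorem; once proportionality is known, a single `k`
  -- suffices.
  · exact ae_eq_of_fundamental_proportional hq.integrable hp.integrable ha 0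
      fun x hx => fundamental_proportional hq hp hW hx.1 hx.2 0
  · have h : ∀ᵐ x : ℝ, x ≠ 1 := by simp [ae_iff, measure_singleton]
    filter_upwards [h] with x hx hxm
    exact absurd (by simpa using hxm) hx

end

end

/-! ### Zero density and Jensen's formula -/

section

open Set intervalIntegral Topology MeromorphicOn

lemma hasDensity_iff {Ω : ℂ → ℕ} {γ : ℝ} (hγ : 0 < γ) :
    HasDensity Ω γ ↔ Tendsto (fun r : ℝ => count Ω r / r) atTop (𝓝 (2 * γ / Real.pi)) := by
  have hpi := Real.pi_pos
  have hc : 2 * γ / Real.pi ≠ 0 := by positivity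
  rw [HasDensity, Asymptotics.isEquivalent_iff_tendsto_one
    ((eventually_gt_atTop 0).mono fun r hr => by positivity)]
  constructor
  · intro h
    have h2 := h.const_mul (2 * γ / Real.pi)
    rw [mul_one] at h2
    refine h2.congr' ((eventually_gt_atTop 0).mono fun r hr => ?_)
    simp only [Pi.div_apply]
    field_simp
  · intro h
    have h2 := h.div_const (2 * γ / Real.pi)
    rw [div_self hc] at h2
    refine h2.congr' ((eventually_gt_atTop 0).mono fun r hr => ?_)
    simp only [Pi.div_apply]
    field_simp

lemma integral_abs_sin : ∫ θ in (0 : ℝ)..2 * Real.pi, |Real.sin θ| = 4 := by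
  have hpi := Real.pi_pos
  have hi : ∀ a b, IntervalIntegrable (fun θ => |Real.sin θ|) volume a b :=
    fun a b => (Real.continuous_sin.abs).intervalIntegrable a b
  rw [← integral_add_adjacent_intervals (hi 0 Real.pi) (hi Real.pi (2 * Real.pi))]
  have h1 : ∫ θ in (0 : ℝ)..Real.pi, |Real.sin θ| = 2 := by
    have : ∫ θ in (0 : ℝ)..Real.pi, |Real.sin θ| = ∫ θ in (0 : ℝ)..Real.pi, Real.sin θ := by
      refine integral_congr fun θ hθ => ?_
      rw [uIcc_of_le hpi.le] at hθ
      exact abs_of_nonneg (Real.sin_nonneg_of_mem_Icc hθ)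
    rw [this, integral_sin, Real.cos_zero, Real.cos_pi]
    norm_num
  have h2 : ∫ θ in Real.pi..2 * Real.pi, |Real.sin θ| = 2 := by
    have := intervalIntegral.integral_comp_add_right (a := 0) (b := Real.pi)
      (fun θ => |Real.sin θ|) Real.pi
    simp only [Real.sin_add_pi, abs_neg, zero_add] at this
    rw [two_mul, ← this, h1]
  rw [h1, h2]
  norm_num

/-- The contribution of one zero of modulus `s` to `∫ N(t) / t`. -/
lemma integral_indicator_inv {s r R : ℝ} (hr : 0 < r) (hrR : r ≤ R) (hsR : s ≤ R) :
    IntervalIntegrable (fun t => if s ≤ t then t⁻¹ else 0) volume r R ∧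
    ∫ t in r..R, (if s ≤ t then t⁻¹ else 0) = Real.log R - Real.log (max s r) := by
  have hm : 0 < max s r := lt_max_of_lt_right hr
  have hrm : r ≤ max s r := le_max_right _ _
  have hmR : max s r ≤ R := max_le hsR hrR
  have e1 : EqOn (fun _ : ℝ => (0 : ℝ)) (fun t => if s ≤ t then t⁻¹ else 0) (Ioo r (max s r)) := by
    intro t ht
    have : t < s := (lt_max_iff.1 ht.2).resolve_right (not_lt.2 ht.1.le)
    simp [not_le.2 this]
  have e2 : EqOn (fun t : ℝ => t⁻¹) (fun t => if s ≤ t then t⁻¹ else 0) (Ioo (max s r) R) := by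
    intro t ht
    simp [(le_max_left s r).trans ht.1.le]
  have i2 : IntervalIntegrable (fun t : ℝ => t⁻¹) volume (max s r) R := by
    refine intervalIntegrable_inv (fun t ht => ?_) continuousOn_id
    rw [uIcc_of_le hmR] at ht
    exact (hm.trans_le ht.1).ne'
  have j1 : IntervalIntegrable (fun t => if s ≤ t then t⁻¹ else 0) volume r (max s r) :=
    (intervalIntegrable_const (c := (0 : ℝ))).congr_uIoo (by rwa [uIoo_of_le hrm])
  have j2 : IntervalIntegrable (fun t => if s ≤ t then t⁻¹ else 0) volume (max s r) R :=
    i2.congr_uIoo (by rwa [uIoo_of_le hmR])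
  refine ⟨j1.trans j2, ?_⟩
  have l1 : ∫ t in r..max s r, (0 : ℝ) = ∫ t in r..max s r, (if s ≤ t then t⁻¹ else 0) :=
    integral_congr_uIoo (by rwa [uIoo_of_le hrm])
  have l2 : ∫ t in max s r..R, t⁻¹ = ∫ t in max s r..R, (if s ≤ t then t⁻¹ else 0) :=
    integral_congr_uIoo (by rwa [uIoo_of_le hmR])
  rw [← integral_add_adjacent_intervals j1 j2, ← l1, ← l2, intervalIntegral.integral_zero, zero_add,
    integral_inv_of_pos hm (hm.trans_le hmR), Real.log_div (hm.trans_le hmR).ne' hm.ne']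

/-- The upper bound for `log |F|` on circles, for `F` of exponential type `σ` in both half-planes
and bounded on the real line. -/
lemma circleAverage_log_norm_le {F : ℂ → ℂ} (hF : Differentiable ℂ F) {C σ R : ℝ} (hC : 1 ≤ C)
    (hσ : 0 ≤ σ) (hR : 0 < R) (hb : ∀ k, ‖k‖ = R → ‖F k‖ ≤ C * Real.exp (σ * |k.im|)) :
    Real.circleAverage (Real.log ‖F ·‖) 0 R ≤ Real.log C + 2 * σ * R / Real.pi := by
  have hpi := Real.pi_pos
  have hcont : Continuous fun k : ℂ => Real.log C + σ * |k.im| := by fun_prop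
  have hcomp : Real.circleAverage (fun k : ℂ => Real.log C + σ * |k.im|) 0 R =
      Real.log C + 2 * σ * R / Real.pi := by
    rw [Real.circleAverage_def]
    have : ∀ θ, Real.log C + σ * |(circleMap 0 R θ).im| = Real.log C + σ * R * |Real.sin θ| := by
      intro θ
      rw [circleMap_zero_im, abs_mul, abs_of_pos hR]
      ring
    simp only [this]
    rw [intervalIntegral.integral_add (by simp)
      ((Real.continuous_sin.abs.const_mul _).intervalIntegrable _ _),
      intervalIntegral.integral_const_mul, integral_abs_sin]
    simp only [intervalIntegral.integral_const, smul_eq_mul]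
    field_simp
    ring
  rw [← hcomp]
  refine Real.circleAverage_mono
    (MeromorphicOn.circleIntegrable_log_norm fun z _ => (hF.analyticAt z).meromorphicAt)
    (hcont.continuousOn.circleIntegrable hR.le) fun k hk => ?_
  have hk' : ‖k‖ = R := by simpa [abs_of_pos hR] using hk
  rcases eq_or_ne (F k) 0 with h0 | h0
  -- At a zero on the circle `Real.log 0 = 0`, so the majorant must be nonnegative; hence `1 ≤ C`.
  · rw [h0, norm_zero, Real.log_zero]
    have := Real.log_nonneg hC
    positivity
  · rw [← Real.log_exp (σ * |k.im|), ← Real.log_mul (by positivity) (Real.exp_pos _).ne']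
    exact Real.log_le_log (norm_pos_iff.2 h0) (hb k hk')

/-- The part of Jensen's formula that bounds the zeros in a subfamily. -/
lemma integral_count_le_circleAverage {F : ℂ → ℂ} (hF : Differentiable ℂ F) {z₀ : ℂ}
    (hz₀ : F z₀ ≠ 0) {Ω : ℂ → ℕ} (hΩ : ∀ z, (Ω z : ℕ∞) ≤ analyticOrderAt F z) {r R : ℝ}
    (hr : 1 ≤ r) (hrR : r ≤ R) :
    IntervalIntegrable (fun t => count Ω t * t⁻¹) volume r R ∧
    ∫ t in r..R, count Ω t * t⁻¹ ≤ Real.circleAverage (Real.log ‖F ·‖) 0 R -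
      Real.log ‖meromorphicTrailingCoeffAt F 0‖ := by
  have hR : 0 < R := by linarith
  have hFa : AnalyticOnNhd ℂ F (Metric.closedBall 0 |R|) := fun z _ => hF.analyticAt z
  set D := divisor F (Metric.closedBall 0 |R|) with hD
  have hfin : (Function.support D).Finite := D.finiteSupport (isCompact_closedBall 0 |R|)
  have hDΩ : ∀ z, ‖z‖ ≤ R → (Ω z : ℤ) ≤ D z := by
    intro z hz
    have hne : analyticOrderAt F z ≠ ⊤ := fun h => hz₀ (by
      rw [(AnalyticOnNhd.analyticOrderAt_eq_top_iff_eq_zero z fun w => hF.analyticAt w).1 h]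
      rfl)
    rw [hD, hFa.divisor_apply (by simpa [abs_of_pos hR] using hz)]
    obtain ⟨n, hn⟩ := ENat.ne_top_iff_exists.1 hne
    have := hΩ z
    rw [← hn] at this ⊢
    simpa using this
  have hsup : ∀ z, ‖z‖ ≤ R → Ω z ≠ 0 → z ∈ hfin.toFinset := by
    intro z hz h0
    have := hDΩ z hz
    simp only [Finite.mem_toFinset, Function.mem_support]
    omega
  have hSR : ∀ z ∈ hfin.toFinset, ‖z‖ ≤ R := by
    intro z hz
    have := D.supportWithinDomain (by simpa using hz)
    simpa [abs_of_pos hR] using this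
  have hcount : ∀ t ≤ R, (count Ω t : ℝ) * t⁻¹ =
      ∑ z ∈ hfin.toFinset, (Ω z : ℝ) * (if ‖z‖ ≤ t then t⁻¹ else 0) := by
    intro t ht
    have : count Ω t = ∑ z ∈ hfin.toFinset with ‖z‖ ≤ t, Ω z := by
      refine finsum_mem_eq_sum_of_inter_support_eq _ ?_
      ext z
      simp only [mem_inter_iff, Metric.mem_closedBall, dist_zero_right, Function.mem_support,
        Finset.coe_filter, mem_ofPred_eq]
      constructor
      · rintro ⟨h1, h2⟩
        exact ⟨⟨hsup z (h1.trans ht) h2, h1⟩, h2⟩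
      · rintro ⟨⟨-, h1⟩, h2⟩
        exact ⟨h1, h2⟩
    rw [this, Finset.sum_filter]
    push_cast
    rw [Finset.sum_mul]
    refine Finset.sum_congr rfl fun z _ => ?_
    split_ifs <;> simp
  have hii : ∀ z ∈ hfin.toFinset, IntervalIntegrable
      (fun t => (Ω z : ℝ) * (if ‖z‖ ≤ t then t⁻¹ else 0)) volume r R := fun z hz =>
    (integral_indicator_inv (by linarith) hrR (hSR z hz)).1.const_mul _
  have heq : EqOn (fun t => ∑ z ∈ hfin.toFinset, (Ω z : ℝ) * (if ‖z‖ ≤ t then t⁻¹ else 0))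
      (fun t => count Ω t * t⁻¹) (uIcc r R) := fun t ht => by
    rw [uIcc_of_le hrR] at ht
    exact (hcount t ht.2).symm
  have hsum := IntervalIntegrable.sum hfin.toFinset hii
  refine ⟨?_, ?_⟩
  · refine hsum.congr_uIoo fun t ht => ?_
    rw [Finset.sum_apply]
    exact heq (Ioo_subset_Icc_self ht)
  rw [← integral_congr heq, intervalIntegral.integral_finsetSum hii,
    MeromorphicOn.circleAverage_log_norm hR.ne' hFa.meromorphicOn,
    ← countingFunction_finsum_eq_finsum_add hR.ne' hfin, add_sub_cancel_right,
    finsum_eq_sum_of_support_subset (s := hfin.toFinset) _ (fun z hz => by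
      simp only [Finite.coe_toFinset, Function.mem_support] at hz ⊢
      exact fun h => hz (by rw [h]; simp))]
  refine Finset.sum_le_sum fun z hz => ?_
  rw [intervalIntegral.integral_const_mul,
    (integral_indicator_inv (by linarith) hrR (hSR z hz)).2, zero_sub, norm_neg]
  have h1 : (Ω z : ℝ) ≤ D z := by exact_mod_cast hDΩ z (hSR z hz)
  -- A zero at the origin enters with `Real.log 0 = 0`, and `1 ≤ r` keeps the comparison valid.
  have h2 : Real.log ‖z‖ ≤ Real.log (max ‖z‖ r) := by
    rcases eq_or_ne z 0 with rfl | h0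
    · rw [norm_zero, Real.log_zero]
      exact Real.log_nonneg (hr.trans (le_max_right _ _))
    · exact Real.log_le_log (norm_pos_iff.2 h0) (le_max_left _ _)
  have h3 : Real.log (max ‖z‖ r) ≤ Real.log R :=
    Real.log_le_log (lt_max_of_lt_right (by linarith)) (max_le (hSR z hz) hrR)
  have h4 : (0 : ℝ) ≤ Ω z := by positivity
  calc (Ω z : ℝ) * (Real.log R - Real.log (max ‖z‖ r))
      ≤ D z * (Real.log R - Real.log (max ‖z‖ r)) := by gcongr
    _ ≤ D z * (Real.log R - Real.log ‖z‖) := by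
      have : (0 : ℝ) ≤ D z := h4.trans h1
      gcongr

/-- An entire function of exponential type `σ` cannot have zeros of density above `2σ/π`. -/
theorem eq_zero_of_hasDensity {F : ℂ → ℂ} (hF : Differentiable ℂ F) {C σ γ R₀ : ℝ} (hσ : 0 ≤ σ)
    (hσγ : σ < γ) (hb : ∀ k, R₀ ≤ ‖k‖ → ‖F k‖ ≤ C * Real.exp (σ * |k.im|)) {Ω : ℂ → ℕ}
    (hN : HasDensity Ω γ) (hΩ : ∀ z, (Ω z : ℕ∞) ≤ analyticOrderAt F z) (k : ℂ) : F k = 0 := by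
  by_contra hk
  have hpi := Real.pi_pos
  -- From some radius on `N(t) / t > 2δ/π`, so Jensen's integral grows with slope at least `2δ/π`,
  -- against the slope `2σ/π` of the circle averages.
  obtain ⟨δ, hδ1, hδ2⟩ := exists_between hσγ
  have hlt : 2 * δ / Real.pi < 2 * γ / Real.pi := by gcongr
  obtain ⟨r₁, hr₁⟩ := eventually_atTop.1
    (((hasDensity_iff (hσ.trans_lt hσγ)).1 hN).eventually (lt_mem_nhds hlt))
  set r := max (max r₁ R₀) 1 with hr
  have hr1 : 1 ≤ r := le_max_right _ _
  set K := Real.log (max C 1) - Real.log ‖meromorphicTrailingCoeffAt F 0‖ +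
    2 * δ / Real.pi * r with hK
  have hmain : ∀ R ≥ r, 2 * δ / Real.pi * R ≤ 2 * σ / Real.pi * R + K := by
    intro R hR
    obtain ⟨hi, hle⟩ := integral_count_le_circleAverage hF hk hΩ hr1 hR
    have hup := circleAverage_log_norm_le hF (C := max C 1) (R := R) (le_max_right _ _) hσ
      (by linarith) fun z hz => (hb z (by
        rw [hz]
        exact ((le_max_right r₁ R₀).trans (le_max_left _ 1)).trans hR)).trans (by
          gcongr
          exact le_max_left _ _)
    have hlow : ∫ _ in r..R, 2 * δ / Real.pi ≤ ∫ t in r..R, count Ω t * t⁻¹ := by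
      refine intervalIntegral.integral_mono_on hR intervalIntegrable_const hi fun t ht => ?_
      exact (hr₁ t (((le_max_left r₁ R₀).trans (le_max_left _ 1)).trans ht.1)).le
    rw [intervalIntegral.integral_const, smul_eq_mul] at hlow
    have e : 2 * σ * R / Real.pi = 2 * σ / Real.pi * R := by ring
    rw [e] at hup
    simp only [hK]
    linarith
  have hpos : 0 < 2 * δ / Real.pi - 2 * σ / Real.pi := by
    rw [sub_pos]
    gcongr
  set R := max r ((K + 1) / (2 * δ / Real.pi - 2 * σ / Real.pi))
  have h1 := hmain R (le_max_left _ _)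
  have h2 : (K + 1) / (2 * δ / Real.pi - 2 * σ / Real.pi) ≤ R := le_max_right _ _
  rw [div_le_iff₀ hpos] at h2
  linarith

end

/-! ### From common zeros to equality of potentials -/

section

open Set intervalIntegral Topology

lemma le_analyticOrderAt_of_mul {n : ℕ∞} {u W : ℂ → ℂ} {z : ℂ} (hu : AnalyticAt ℂ u z)
    (hW : AnalyticAt ℂ W z) (huz : u z ≠ 0) (h : n ≤ analyticOrderAt (u * W) z) :
    n ≤ analyticOrderAt W z := by
  rwa [analyticOrderAt_mul hu hW, hu.analyticOrderAt_eq_zero.2 huz, zero_add] at h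

lemma le_analyticOrderAt_mul_sub_mul {n : ℕ∞} {f₁ g₁ f₂ g₂ : ℂ → ℂ} {z : ℂ}
    (hf₁ : AnalyticAt ℂ f₁ z) (hg₁ : AnalyticAt ℂ g₁ z) (hf₂ : AnalyticAt ℂ f₂ z)
    (hg₂ : AnalyticAt ℂ g₂ z) (h₁ : n ≤ analyticOrderAt g₁ z) (h₂ : n ≤ analyticOrderAt g₂ z) :
    n ≤ analyticOrderAt (f₁ * g₁ - f₂ * g₂) z := by
  refine le_trans (le_min ?_ ?_) (le_analyticOrderAt_sub (𝕜 := ℂ))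
  · rw [analyticOrderAt_mul hf₁ hg₁]
    exact h₁.trans le_add_self
  · rw [analyticOrderAt_mul hf₂ hg₂]
    exact h₂.trans le_add_self

section

variable {p q : ℝ → ℝ}

lemma jostMinus_eq_of_ae_eq (hq : Q1 q) (hp : Q1 p) {a : ℝ} (ha : 0 ≤ a)
    (h : ∀ᵐ x, x ∈ Icc (0 : ℝ) a → p x = q x) (k : ℂ) :
    jostMinus q k a = jostMinus p k a ∧ deriv (jostMinus q k) a = deriv (jostMinus p k) a := by
  refine eq_of_ae_eq hq.integrable hp.integrable (isSolution_jostMinus hq k)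
    (isSolution_jostMinus hp k) (x₁ := 0) ?_ (by rw [jostMinus_zero hq, jostMinus_zero hp])
    (by rw [deriv_jostMinus_zero hq, deriv_jostMinus_zero hp])
  filter_upwards [h] with t ht htm
  rw [uIoc_of_le ha] at htm
  exact ht (Ioc_subset_Icc_self htm)

/-- Zero Cauchy data at `x` would make the solution vanish identically, against its value `1` at
`0`. -/
lemma jostMinus_ne_zero (hq : Q1 q) (k : ℂ) (x : ℝ) :
    jostMinus q k x ≠ 0 ∨ deriv (jostMinus q k) x ≠ 0 := by
  by_contra! h
  have h0 := congrFun ((isSolution_jostMinus hq k).eq_fundamental hq.integrable x) 0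
  rw [jostMinus_zero hq, h.1, h.2] at h0
  simp at h0

lemma differentiable_wronskian_jostPlus (hq : Q1 q) (hp : Q1 p) (x : ℝ) :
    Differentiable ℂ fun k => wronskian (jostPlus q k) (jostPlus p k) x :=
  ((differentiable_jostPlus hq x).1.mul (differentiable_jostPlus hp x).2).sub
    ((differentiable_jostPlus hq x).2.mul (differentiable_jostPlus hp x).1)

/-- Common zeros of `ω_q` and `ω_p` are zeros of the Wronskian of the right Jost solutions at `a`,
with multiplicity, when the potentials agree on `[0, a]`. -/
lemma le_analyticOrderAt_wronskian_jostPlus (hq : Q1 q) (hp : Q1 p) {a : ℝ} (ha : 0 ≤ a)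
    (h : ∀ᵐ x, x ∈ Icc (0 : ℝ) a → p x = q x) {n : ℕ∞} {z : ℂ}
    (hnq : n ≤ analyticOrderAt (omega q) z) (hnp : n ≤ analyticOrderAt (omega p) z) :
    n ≤ analyticOrderAt (fun k => wronskian (jostPlus q k) (jostPlus p k) a) z := by
  have hW := (differentiable_wronskian_jostPlus hq hp a).analyticAt z
  have hωq := (differentiable_omega hq).analyticAt z
  have hωp := (differentiable_omega hp).analyticAt z
  obtain ⟨dq, dq'⟩ := differentiable_jostPlus hq a
  obtain ⟨dp, dp'⟩ := differentiable_jostPlus hp a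
  obtain ⟨du, dv⟩ := differentiable_jostMinus hq a
  have eq : ∀ k, omega q k = jostMinus q k a * deriv (jostPlus q k) a -
      deriv (jostMinus q k) a * jostPlus q k a := fun k => omega_eq hq k a
  have ep : ∀ k, omega p k = jostMinus q k a * deriv (jostPlus p k) a -
      deriv (jostMinus q k) a * jostPlus p k a := fun k => by
    obtain ⟨h1, h2⟩ := jostMinus_eq_of_ae_eq hq hp ha h k
    rw [h1, h2]
    exact omega_eq hp k a
  -- Eliminating `u'` or `u` from the formulas for `ω_q` and `ω_p` gives `u W` or `u' W` as a
  -- combination of them; the factor not vanishing at `z` is cancelled without loss of order.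
  rcases jostMinus_ne_zero hq z a with h0 | h0
  · refine le_analyticOrderAt_of_mul (du.analyticAt z) hW h0 ?_
    have e : (fun k => jostMinus q k a) * (fun k => wronskian (jostPlus q k) (jostPlus p k) a) =
        (fun k => jostPlus q k a) * omega p - (fun k => jostPlus p k a) * omega q := by
      funext k
      simp only [Pi.mul_apply, Pi.sub_apply, eq, ep, wronskian]
      ring
    rw [e]
    exact le_analyticOrderAt_mul_sub_mul (dq.analyticAt z) hωp (dp.analyticAt z) hωq hnp hnq
  · refine le_analyticOrderAt_of_mul (dv.analyticAt z) hW h0 ?_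
    have e : (fun k => deriv (jostMinus q k) a) *
        (fun k => wronskian (jostPlus q k) (jostPlus p k) a) =
        (fun k => deriv (jostPlus q k) a) * omega p -
          (fun k => deriv (jostPlus p k) a) * omega q := by
      funext k
      simp only [Pi.mul_apply, Pi.sub_apply, eq, ep, wronskian]
      ring
    rw [e]
    exact le_analyticOrderAt_mul_sub_mul (dq'.analyticAt z) hωp (dp'.analyticAt z) hωq hnp hnq

/-- The Wronskian vanishes at `1`, so only `[a, 1]` contributes, and each Jost factor costs `exp ((1
- a)|Im k|)` besides `exp (-Im k)`. -/
lemma norm_wronskian_jostPlus_le (hq : Q1 q) (hp : Q1 p) {a : ℝ} (ha : a ≤ 1) {k : ℂ} (hk : k ≠ 0)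
    (hkq : 2 * potNorm q ≤ ‖k‖) (hkp : 2 * potNorm p ≤ ‖k‖) :
    ‖wronskian (jostPlus q k) (jostPlus p k) a‖ ≤
      16 * Real.exp (-(2 * k.im)) * Real.exp (2 * (1 - a) * |k.im|) *
        potNorm (fun t => p t - q t) := by
  have h := wronskian_sub hq.integrable hp.integrable (isSolution_jostPlus hq k)
    (isSolution_jostPlus hp k) 1 a
  have h1 : wronskian (jostPlus q k) (jostPlus p k) 1 = 0 := by
    rw [wronskian, jostPlus_one hq, jostPlus_one hp, deriv_jostPlus_one hq, deriv_jostPlus_one hp]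
    ring
  rw [h1, sub_zero] at h
  simp only [← Complex.ofReal_sub] at h
  rw [h]
  refine norm_integral_mul_le_potNorm (hp.integrable.sub hq.integrable) (by positivity)
    fun t ht => ?_
  rw [uIoc_of_ge ha] at ht
  have b1 := norm_jostPlus_le hq hk hkq t
  have b2 := norm_jostPlus_le hp hk hkp t
  rw [abs_sub_comm, abs_of_nonneg (show (0 : ℝ) ≤ 1 - t by linarith [ht.2])] at b1 b2
  have hat := ht.1.le
  rw [norm_mul]
  calc ‖jostPlus q k t‖ * ‖jostPlus p k t‖
      ≤ (4 * Real.exp (-k.im) * Real.exp (|k.im| * (1 - a))) *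
        (4 * Real.exp (-k.im) * Real.exp (|k.im| * (1 - a))) := by
        have := b1.trans (show _ ≤ 4 * Real.exp (-k.im) * Real.exp (|k.im| * (1 - a)) by gcongr)
        have := b2.trans (show _ ≤ 4 * Real.exp (-k.im) * Real.exp (|k.im| * (1 - a)) by gcongr)
        gcongr
    _ = 16 * (Real.exp (-k.im) * Real.exp (-k.im)) *
        (Real.exp (|k.im| * (1 - a)) * Real.exp (|k.im| * (1 - a))) := by ring
    _ = _ := by
      rw [← Real.exp_add, ← Real.exp_add]
      ring_nf

/-- A subfamily of the zeros of `ω_q` of density `2γ/π`, `γ > 2(1 - a)`, and `q` on `[0, a]`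
determine `q`. -/
theorem determines_of_hasDensity {a γ : ℝ} (ha : 0 ≤ a) (ha1 : a ≤ 1) (hγ : 2 * (1 - a) < γ)
    (hq : Q1 q) {Ω : ℂ → ℕ} (hΩ : IsSubfamilyOfZeros Ω q) (hN : HasDensity Ω γ) :
    Determines a Ω q := by
  intro p hp hpq hΩp
  set W : ℂ → ℂ := fun k => wronskian (jostPlus q k) (jostPlus p k) a with hWdef
  have hWd : Differentiable ℂ W := differentiable_wronskian_jostPlus hq hp a
  -- Multiplying by the zero-free `e^{-2ik}` removes `exp (-2 Im k)` and leaves a bound symmetric in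
  -- the two half-planes.
  have hEd : Differentiable ℂ fun k : ℂ => Complex.exp (Complex.I * (-(2 * k))) := by fun_prop
  have hF := eq_zero_of_hasDensity (hEd.mul hWd) (C := 16 * potNorm (fun t => p t - q t))
    (σ := 2 * (1 - a)) (R₀ := max (2 * potNorm q) (2 * potNorm p) + 1) (by linarith) hγ
    (fun k hk => by
      have m1 := le_max_left (2 * potNorm q) (2 * potNorm p)
      have m2 := le_max_right (2 * potNorm q) (2 * potNorm p)
      have hk0 : k ≠ 0 := norm_pos_iff.1 (by linarith [potNorm_nonneg q])
      have hb := norm_wronskian_jostPlus_le hq hp ha1 hk0 (by linarith) (by linarith)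
      rw [Pi.mul_apply, norm_mul, norm_exp_I_mul]
      have e : -(-(2 * k)).im = 2 * k.im := by simp
      rw [e]
      calc _ ≤ Real.exp (2 * k.im) * _ := mul_le_mul_of_nonneg_left hb (Real.exp_pos _).le
        _ = 16 * potNorm (fun t => p t - q t) * Real.exp (2 * (1 - a) * |k.im|) *
            (Real.exp (2 * k.im) * Real.exp (-(2 * k.im))) := by ring
        _ = _ := by rw [← Real.exp_add]; simp)
    hN (fun z => by
      rw [analyticOrderAt_mul (hEd.analyticAt z) (hWd.analyticAt z)]
      exact (le_analyticOrderAt_wronskian_jostPlus hq hp ha hpq (hΩ z) (hΩp z)).trans le_add_self)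
  have hW : ∀ k, W k = 0 := fun k =>
    (mul_eq_zero.1 (hF k)).resolve_left (Complex.exp_ne_zero _)
  filter_upwards [hpq, ae_eq_of_wronskian_jostPlus_eq_zero hq hp ha1 hW] with x h1 h2 hx
  rcases le_total x a with hxa | hxa
  · exact h1 ⟨hx.1, hxa⟩
  · exact h2 ⟨hxa, hx.2⟩

end

/-! ### Removing an infinite set of density zero -/

section Thinning

variable {Ω : ℂ → ℕ} {γ : ℝ}

/-- A `finsum` over an infinite support is `0`, but positive density makes the count nonzero at some
larger radius. -/
lemma HasDensity.finite_inter_support (hγ : 0 < γ) (hN : HasDensity Ω γ) (r : ℝ) :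
    (Metric.closedBall (0 : ℂ) r ∩ Function.support Ω).Finite := by
  have hpos : (0 : ℝ) < 2 * γ / Real.pi := by
    have := Real.pi_pos
    positivity
  obtain ⟨R, hR, hrR⟩ := ((((hasDensity_iff hγ).1 hN).eventually (lt_mem_nhds hpos)).and
    (eventually_ge_atTop r)).exists
  have : (Metric.closedBall (0 : ℂ) R ∩ Function.support Ω).Finite := by
    by_contra h
    rw [count, finsum_mem_eq_zero_of_infinite h] at hR
    simp at hR
  exact this.subset (inter_subset_inter_left _ (Metric.closedBall_subset_closedBall hrR))

lemma count_eq_sum {r : ℝ} (hfin : (Metric.closedBall (0 : ℂ) r ∩ Function.support Ω).Finite)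
    {Λ : ℂ → ℕ} (hΛ : Λ ≤ Ω) : count Λ r = ∑ z ∈ hfin.toFinset, Λ z := by
  refine finsum_mem_eq_sum_of_subset _ (fun z hz => ?_) (fun z hz => ?_)
  · have h1 : Λ z ≠ 0 := hz.2
    have h2 : Λ z ≤ Ω z := hΛ z
    simp only [Finite.coe_toFinset]
    exact ⟨hz.1, (Nat.pos_of_ne_zero h1 |>.trans_le h2).ne'⟩
  · simp only [Finite.coe_toFinset] at hz
    exact hz.1

/-- Multiplicities in a family of linear density are of lower order. -/
lemma HasDensity.exists_bound (hγ : 0 < γ) (hN : HasDensity Ω γ) {ε : ℝ} (hε : 0 < ε) :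
    ∃ R, ∀ z, R ≤ ‖z‖ → (Ω z : ℝ) ≤ ε * ‖z‖ := by
  have hlim := (hasDensity_iff hγ).1 hN
  -- The multiplicity at `z` is at most `N(‖z‖) - N(‖z‖ - 1)`, which is `o(‖z‖)` because both terms
  -- have the same linear asymptotics.
  have h1 : Tendsto (fun r : ℝ => (count Ω (r - 1) : ℝ) / (r - 1)) atTop (𝓝 (2 * γ / Real.pi)) :=
    hlim.comp (tendsto_atTop_add_const_right atTop (-1 : ℝ) tendsto_id)
  have h2 : Tendsto (fun r : ℝ => (r - 1) / r) atTop (𝓝 1) := by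
    have := (tendsto_const_nhds (x := (1 : ℝ))).sub (tendsto_inv_atTop_zero (𝕜 := ℝ))
    rw [sub_zero] at this
    refine this.congr' ((eventually_gt_atTop 0).mono fun r hr => ?_)
    field_simp
  have h3 := hlim.sub (h1.mul h2)
  rw [mul_one, sub_self] at h3
  obtain ⟨R, hR⟩ := eventually_atTop.1 ((h3.eventually (gt_mem_nhds hε)).and (eventually_gt_atTop 1))
  refine ⟨R, fun z hz => ?_⟩
  obtain ⟨hr, hr1⟩ := hR _ hz
  have hle : count Ω (‖z‖ - 1) + Ω z ≤ count Ω ‖z‖ := by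
    rcases Nat.eq_zero_or_pos (Ω z) with h0 | h0
    · rw [h0, add_zero, count_eq_sum (hN.finite_inter_support hγ _) le_rfl,
        count_eq_sum (hN.finite_inter_support hγ _) le_rfl]
      refine Finset.sum_le_sum_of_subset (Finite.toFinset_subset_toFinset.2 ?_)
      exact inter_subset_inter_left _ (Metric.closedBall_subset_closedBall (by linarith))
    · have hnot : z ∉ (hN.finite_inter_support hγ (‖z‖ - 1)).toFinset := by
        simp
      rw [count_eq_sum (hN.finite_inter_support hγ _) le_rfl,
        count_eq_sum (hN.finite_inter_support hγ _) le_rfl, add_comm, ← Finset.sum_insert hnot]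
      refine Finset.sum_le_sum_of_subset fun w hw => ?_
      rcases Finset.mem_insert.1 hw with rfl | hw
      · simp [h0.ne']
      · simp only [Finite.mem_toFinset] at hw ⊢
        exact ⟨Metric.closedBall_subset_closedBall (by linarith) hw.1, hw.2⟩
  have hle' : (count Ω (‖z‖ - 1) : ℝ) + Ω z ≤ count Ω ‖z‖ := by exact_mod_cast hle
  have hz0 : 0 < ‖z‖ := by linarith
  have hz1 : ‖z‖ - 1 ≠ 0 := by linarith
  rw [div_mul_div_cancel₀ hz1, ← sub_div, div_lt_iff₀ hz0] at hr
  linarith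

/-- Otherwise the count would be eventually constant and the density zero. -/
lemma HasDensity.exists_norm_gt (hγ : 0 < γ) (hN : HasDensity Ω γ) (r : ℝ) :
    ∃ z, Ω z ≠ 0 ∧ r < ‖z‖ := by
  by_contra! h
  have hlim := (hasDensity_iff hγ).1 hN
  have hc : ∀ R, r ≤ R → count Ω R = count Ω r := fun R hR => by
    refine finsum_mem_inter_support_eq _ _ _ ?_
    ext z
    simp only [mem_inter_iff, Metric.mem_closedBall, dist_zero_right, Function.mem_support]
    exact ⟨fun hz => ⟨h z hz.2, hz.2⟩, fun hz => ⟨hz.1.trans hR, hz.2⟩⟩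
  have h0 : Tendsto (fun R : ℝ => (count Ω R : ℝ) / R) atTop (𝓝 0) := by
    refine (tendsto_id.const_div_atTop (count Ω r : ℝ)).congr'
      ((eventually_ge_atTop r).mono fun R hR => ?_)
    simp [hc R hR]
  have := tendsto_nhds_unique hlim h0
  have hpos : (0 : ℝ) < 2 * γ / Real.pi := by
    have := Real.pi_pos
    positivity
  linarith

/-- A family of linear density stays of the same density after the removal of a suitable infinite
set. -/
theorem HasDensity.exists_thinning (hγ : 0 < γ) (hN : HasDensity Ω γ) :
    ∃ Ω' : ℂ → ℕ, Ω' ≤ Ω ∧ {z : ℂ | Ω' z = 0 ∧ 0 < Ω z}.Infinite ∧ HasDensity Ω' γ := by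
  classical
  -- The points to be removed: increasing moduli make them distinct, and the factor `2⁻ⁿ` provides a
  -- summable majorant.
  have hstep : ∀ (n : ℕ) (x : ℂ), ∃ z, (Ω z ≠ 0 ∧ (Ω z : ℝ) ≤ (1 / 2) ^ n * ‖z‖) ∧ ‖x‖ < ‖z‖ := by
    intro n x
    obtain ⟨R, hR⟩ := hN.exists_bound hγ (ε := (1 / 2) ^ n) (by positivity)
    obtain ⟨z, h1, h2⟩ := hN.exists_norm_gt hγ (max R ‖x‖)
    exact ⟨z, ⟨h1, hR z ((le_max_left _ _).trans h2.le)⟩, (le_max_right _ _).trans_lt h2⟩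
  choose f hf hf' using hstep
  let z : ℕ → ℂ := fun n => Nat.rec (f 0 0) (fun n x => f (n + 1) x) n
  have hz : ∀ n, Ω (z n) ≠ 0 ∧ (Ω (z n) : ℝ) ≤ (1 / 2) ^ n * ‖z n‖ := by
    rintro (_ | n)
    · exact hf 0 0
    · exact hf (n + 1) (z n)
  have hmono : StrictMono fun n => ‖z n‖ := strictMono_nat_of_lt_succ fun n => hf' (n + 1) (z n)
  have hinj : Function.Injective z := fun i j hij => hmono.injective (by simp only [hij])
  let Ω' : ℂ → ℕ := fun w => if w ∈ range z then 0 else Ω w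
  let Λ : ℂ → ℕ := fun w => if w ∈ range z then Ω w else 0
  have hΩ' : Ω' ≤ Ω := fun w => by
    simp only [Ω']
    split_ifs <;> simp
  have hΛ : Λ ≤ Ω := fun w => by
    simp only [Λ]
    split_ifs <;> simp
  have hfin := hN.finite_inter_support hγ
  have hadd : ∀ r, count Ω r = count Ω' r + count Λ r := fun r => by
    rw [count_eq_sum (hfin r) le_rfl, count_eq_sum (hfin r) hΩ', count_eq_sum (hfin r) hΛ,
      ← Finset.sum_add_distrib]
    refine Finset.sum_congr rfl fun w _ => ?_
    simp only [Ω', Λ]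
    split_ifs <;> simp
  have hcount : ∀ r : ℝ, (count Λ r : ℝ) / r =
      ∑' j, if ‖z j‖ ≤ r then (Ω (z j) : ℝ) / r else 0 := fun r => by
    rw [count_eq_sum (hfin r) hΛ, ← Finset.sum_preimage z _ hinj.injOn _ (fun w _ hw => by
      simp only [Λ, if_neg hw]), tsum_eq_sum (s := (hfin r).toFinset.preimage z hinj.injOn)]
    · push_cast
      rw [Finset.sum_div]
      refine Finset.sum_congr rfl fun j hj => ?_
      have : ‖z j‖ ≤ r := by
        simp only [Finset.mem_preimage, Finite.mem_toFinset] at hj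
        simpa using hj.1
      simp [Λ, this]
    · intro j hj
      simp only [Finset.mem_preimage, Finite.mem_toFinset, mem_inter_iff, Metric.mem_closedBall,
        dist_zero_right, Function.mem_support, not_and_or, (hz j).1, not_true_eq_false, or_false,
        ne_eq, not_false_eq_true] at hj
      exact if_neg hj
  -- The `j`-th term is nonzero only for `r ≥ ‖z j‖`, so it is at most `Ω (z j) / ‖z j‖ ≤ 2⁻ʲ`, and
  -- it tends to `0`; dominated convergence needs no rate for the moduli.
  have hΛ0 : Tendsto (fun r : ℝ => (count Λ r : ℝ) / r) atTop (𝓝 0) := by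
    simp only [hcount]
    rw [← tsum_zero (β := ℕ)]
    refine tendsto_tsum_of_dominated_convergence (bound := fun j : ℕ => (1 / 2 : ℝ) ^ j)
      summable_geometric_two (fun j => ?_) ?_
    · refine (tendsto_id.const_div_atTop (Ω (z j) : ℝ)).congr'
        ((eventually_ge_atTop ‖z j‖).mono fun R hR => ?_)
      simp [hR]
    · filter_upwards [eventually_gt_atTop 0] with r hr j
      split_ifs with h
      · rw [Real.norm_of_nonneg (by positivity), div_le_iff₀ hr]
        exact (hz j).2.trans (by gcongr)
      · simp
  refine ⟨Ω', hΩ', (infinite_range_of_injective hinj).mono ?_, (hasDensity_iff hγ).2 ?_⟩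
  · rintro w ⟨j, rfl⟩
    exact ⟨by simp [Ω'], Nat.pos_of_ne_zero (hz j).1⟩
  · have := ((hasDensity_iff hγ).1 hN).sub hΛ0
    rw [sub_zero] at this
    refine this.congr fun r => ?_
    rw [hadd r]
    push_cast
    ring

end Thinning

end

end InverseResonance

end

theorem theorem2 (a γ : ℝ) (ha : 1 / 2 < a) (ha1 : a ≤ 1) (hγ : 2 * (1 - a) < γ)
    (q : ℝ → ℝ) (hq : InverseResonance.Q1 q)
    (Ω : ℂ → ℕ) (hΩ : InverseResonance.IsSubfamilyOfZeros Ω q)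
    (hN : InverseResonance.HasDensity Ω γ) :
    InverseResonance.Determines a Ω q ∧
      ∃ Ω' : ℂ → ℕ, Ω' ≤ Ω ∧ {z : ℂ | Ω' z = 0 ∧ 0 < Ω z}.Infinite ∧
        InverseResonance.HasDensity Ω' γ ∧ InverseResonance.Determines a Ω' q := by
  obtain ⟨Ω', h1, h2, h3⟩ := hN.exists_thinning (by linarith)
  have hΩ' : InverseResonance.IsSubfamilyOfZeros Ω' q := fun z =>
    le_trans (by exact_mod_cast h1 z) (hΩ z)
  exact ⟨InverseResonance.determines_of_hasDensity (by linarith) ha1 hγ hq hΩ hN, Ω', h1, h2, h3,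
    InverseResonance.determines_of_hasDensity (by linarith) ha1 hγ hq hΩ' h3⟩
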